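/- Let $n\ge 1$ be an integer and let $1<p_0,\dots,p_n<\infty$ satisfy $\frac1{p_0}+\dots+\frac1{p_n}=1$. For complex-valued Schwartz functions $F_0,\dots,F_n$ on $\mathbb{R}^n$ and $0<r<R$ define the truncated simplex Hilbert transform $$\Lambda_{n,r,R}:=\int_{r\le |x_0+\dots+x_n|\le R}\ \prod_{i=0}^{n}F_i(x_0,\dots,x_{i-1},x_{i+1},\dots,x_n)\,\frac{1}{x_0+\dots+x_n}\,dx_0\cdots dx_n ,$$ where the integral is over a subset of $\mathbb{R}^{n+1}$ and converges absolutely. There exist a finite constant $C$ and a number $\epsilon>0$, both depending only on $n$ and $p_0,\dots,p_n$, such that for all Schwartz functions $F_0,\dots,F_n$ on $\mathbb{R}^n$ and all $0<r<R$, $$|\Lambda_{n,r,R}|\le C\Big(\log\frac Rr\Big)^{1-\epsilon}\prod_{i=0}^n\|F_i\|_{L^{p_i}(\mathbb{R}^n)} .$$ -/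

import Mathlib

open MeasureTheory
open scoped SchwartzMap

noncomputable section

/-- The region `{x ∈ ℝ^{n+1} : r ≤ |x₀ + ⋯ + xₙ| ≤ R}` of integration. -/
def truncationRegion (n : ℕ) (r R : ℝ) : Set (Fin (n + 1) → ℝ) :=
  {x | r ≤ |∑ i, x i| ∧ |∑ i, x i| ≤ R}

/-- The integrand `∏ᵢ Fᵢ(x₀, …, xᵢ₋₁, xᵢ₊₁, …, xₙ) · 1 / (x₀ + ⋯ + xₙ)`.
The vector `i.removeNth x` is `x` with its `i`-th coordinate deleted. -/
def simplexIntegrand {n : ℕ} (F : Fin (n + 1) → (Fin n → ℝ) → ℂ) (x : Fin (n + 1) → ℝ) : ℂ :=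
  (∏ i, F i (i.removeNth x)) * (1 / ((∑ i, x i : ℝ) : ℂ))

/-- The truncated simplex Hilbert transform `Λ_{n,r,R}(F₀, …, Fₙ)`, an integral with respect to
Lebesgue measure on `ℝ^{n+1}`. -/
def truncatedSimplexHilbert {n : ℕ} (r R : ℝ) (F : Fin (n + 1) → (Fin n → ℝ) → ℂ) : ℂ :=
  ∫ x in truncationRegion n r R, simplexIntegrand F x

end

/-!
The gain of a power of `log (R / r)` over the trivial bound comes from the heat flow. Write `g τ`
for the centred Gaussian density of variance `τ`, that is `heat τ`. As
`∫ τ in a..b, τ ^ (-1 / 2) * (g τ)' s` is, up to a constant, the smooth truncation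
`(exp (-s² / 2b) - exp (-s² / 2a)) / s` of `1 / s`, and this differs from the sharp truncation with
`a = r²`, `b = R²` by a function that is bounded in `L¹` uniformly in `r` and `R`, it suffices to
bound the form with the smooth kernel.

For real functions and the exponents `2, 4, …, 2ⁿ, 2ⁿ`, one doubles the coordinates one after the
other. For a set `J` of doubled coordinates, each `j ∈ J` has two versions `x j`, `x' j`, and `form`
integrates the product of all values of the functions `F i`, `i ∉ J`, at all choices of versions,
against the Gaussian kernel `∏ j ∈ J, g τ (x j - x' j) * g τ S`, where `S` is the sum of the
midpoints of the doubled coordinates and of the other coordinates.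

* The time derivative of this form is a combination of the *energies* of the directions `j ∈ J` and
  of the form in which `g τ S` is replaced by its second derivative. Each energy is an integral of
  squares (`integral_heatDeriv_heatDeriv_heat`, `form_energyPoly_nonneg`), and the form itself is
  bounded by one, by Hölder's inequality. Hence the time integral of a single energy is controlled
  by that of the form with `(g τ)'' S` (`integral_energy_le`).
* The form with `(g τ)'' S` is controlled by the energy in a further direction `k ∉ J`
  (`abs_integral_center_le`): the function `F k` does not depend on the coordinate `k` and is
  removed by the Cauchy–Schwarz inequality, which doubles all terms that do. Integrated over
  `τ ∈ [a, b]`, the geometric mean of the trivial bound `log (b / a)` and of a bound with a gain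
  still has half of the gain (`integral_le_of_energy`).
* When only one coordinate is undoubled, the form with `(g τ)'' S` vanishes, because its only
  remaining function does not depend on that coordinate and `(g τ)''` has integral zero
  (`form_centerPoly_eq_zero`). This starts the induction `exists_integral_energy_le`, which runs
  down to one doubled coordinate; one more application of the Cauchy–Schwarz inequality, with
  `(g τ)'` in place of `(g τ)''`, gives `exists_smooth_bound`.

All other exponents follow by complex interpolation between these special exponents, with the gain,
and suitable others, with the trivial bound `2 * log (R / r)`, since the reciprocals of the given
exponents are an interior point of the simplex (`norm_integral_le_of_interpolation`,
`exists_interpolation_weights`).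
-/

noncomputable section

namespace SimplexHilbert

/-! ### The heat kernel on the line -/

/-- The centred Gaussian density of variance `τ`. -/
def heat (τ x : ℝ) : ℝ := (√(2 * Real.pi * τ))⁻¹ * Real.exp (-x ^ 2 / (2 * τ))

/-- The quotient of the second derivative of the heat kernel by the heat kernel. -/
def heatQuad (τ x : ℝ) : ℝ := x ^ 2 / τ ^ 2 - 1 / τ

/-- The spatial derivative of the heat kernel. -/
def heatDeriv (τ x : ℝ) : ℝ := -(x / τ) * heat τ x

lemma heat_nonneg (τ x : ℝ) : 0 ≤ heat τ x := by unfold heat; positivity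

lemma heat_neg (τ x : ℝ) : heat τ (-x) = heat τ x := by simp [heat]

@[fun_prop]
lemma measurable_heat {α : Type*} [MeasurableSpace α] {f g : α → ℝ} (hf : Measurable f)
    (hg : Measurable g) : Measurable fun a => heat (f a) (g a) := by
  unfold heat; fun_prop

@[fun_prop]
lemma measurable_heatQuad {α : Type*} [MeasurableSpace α] {f g : α → ℝ} (hf : Measurable f)
    (hg : Measurable g) : Measurable fun a => heatQuad (f a) (g a) := by
  unfold heatQuad; fun_prop

@[fun_prop]
lemma measurable_heatDeriv {α : Type*} [MeasurableSpace α] {f g : α → ℝ} (hf : Measurable f)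
    (hg : Measurable g) : Measurable fun a => heatDeriv (f a) (g a) := by
  unfold heatDeriv; fun_prop

lemma integrable_pow_mul_heat {τ : ℝ} (hτ : 0 < τ) (k : ℕ) :
    Integrable fun x => x ^ k * heat τ x := by
  have h := integrable_rpow_mul_exp_neg_mul_sq (b := 1 / (2 * τ)) (by positivity) (s := k)
    (by have : (0 : ℝ) ≤ k := k.cast_nonneg
        linarith)
  refine (h.const_mul (√(2 * Real.pi * τ))⁻¹).congr (ae_of_all _ fun x => ?_)
  simp only [heat, Real.rpow_natCast]
  rw [show -(1 / (2 * τ)) * x ^ 2 = -x ^ 2 / (2 * τ) by ring]; ring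

lemma integrable_heat {τ : ℝ} (hτ : 0 < τ) : Integrable (heat τ) := by
  simpa using integrable_pow_mul_heat hτ 0

lemma integral_heat {τ : ℝ} (hτ : 0 < τ) : ∫ x, heat τ x = 1 := by
  have h := integral_gaussian (1 / (2 * τ))
  simp only [heat]
  rw [integral_const_mul]
  have : ∀ x : ℝ, -x ^ 2 / (2 * τ) = -(1 / (2 * τ)) * x ^ 2 := fun x => by ring
  simp only [this, h]
  rw [show Real.pi / (1 / (2 * τ)) = 2 * Real.pi * τ by field_simp]
  have := Real.pi_pos
  exact inv_mul_cancel₀ (by positivity)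

lemma hasDerivAt_heat {τ : ℝ} (x : ℝ) : HasDerivAt (heat τ) (heatDeriv τ x) x := by
  unfold heatDeriv heat
  have h : HasDerivAt (fun x : ℝ => -x ^ 2 / (2 * τ)) (-(2 * x) / (2 * τ)) x := by
    simpa using ((hasDerivAt_pow 2 x).neg.div_const (2 * τ))
  convert! (h.exp.const_mul (√(2 * Real.pi * τ))⁻¹) using 1
  rw [show -(2 * x) / (2 * τ) = -(x / τ) by
    rw [neg_div, mul_div_mul_left _ _ (two_ne_zero)]]
  ring

lemma hasDerivAt_heatDeriv {τ : ℝ} (hτ : 0 < τ) (x : ℝ) :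
    HasDerivAt (heatDeriv τ) (heatQuad τ x * heat τ x) x := by
  have h := (((hasDerivAt_id x).div_const τ).fun_neg).fun_mul (hasDerivAt_heat (τ := τ) x)
  convert! h using 1
  simp only [heatDeriv, heatQuad, id]
  field_simp
  ring

/-- The heat equation. -/
lemma hasDerivAt_heat_var {τ : ℝ} (hτ : 0 < τ) (x : ℝ) :
    HasDerivAt (fun t => heat t x) (heatQuad τ x / 2 * heat τ x) τ := by
  have hp := Real.pi_pos
  have h1 : HasDerivAt (fun t : ℝ => √(2 * Real.pi * t))
      ((2 * Real.pi) / (2 * √(2 * Real.pi * τ))) τ := by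
    have := ((hasDerivAt_id τ).const_mul (2 * Real.pi)).sqrt (by simp; positivity)
    simpa using this
  have h2 : HasDerivAt (fun t : ℝ => -x ^ 2 / (2 * t)) (x ^ 2 / (2 * τ ^ 2)) τ := by
    have h := (((hasDerivAt_id τ).const_mul 2).fun_inv (by simp; positivity)).const_mul (-x ^ 2)
    convert! h using 1
    · simp only [id]; field_simp
  have hs : (√(2 * Real.pi * τ)) ^ 2 = 2 * Real.pi * τ := Real.sq_sqrt (by positivity)
  have hs0 : 0 < √(2 * Real.pi * τ) := by positivity
  convert! (h1.fun_inv hs0.ne').mul h2.exp using 1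
  simp only [heat, heatQuad]
  rw [hs]
  field_simp
  ring

lemma integral_heatDeriv {τ : ℝ} (hτ : 0 < τ) : ∫ x, heatDeriv τ x = 0 := by
  refine integral_eq_zero_of_hasDerivAt_of_integrable (hasDerivAt_heat (τ := τ)) ?_
    (integrable_heat hτ)
  refine ((integrable_pow_mul_heat hτ 1).const_mul (-(1 / τ))).congr (ae_of_all _ fun x => ?_)
  simp only [heatDeriv]; ring

lemma integrable_heatDeriv {τ : ℝ} (hτ : 0 < τ) : Integrable (heatDeriv τ) := by
  refine ((integrable_pow_mul_heat hτ 1).const_mul (-(1 / τ))).congr (ae_of_all _ fun x => ?_)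
  simp only [heatDeriv]; ring

lemma integrable_heatQuad_mul_heat {τ : ℝ} (hτ : 0 < τ) :
    Integrable fun x => heatQuad τ x * heat τ x := by
  refine (((integrable_pow_mul_heat hτ 2).const_mul (1 / τ ^ 2)).sub
    ((integrable_heat hτ).const_mul (1 / τ))).congr (ae_of_all _ fun x => ?_)
  simp only [heatQuad, Pi.sub_apply]; ring

lemma integral_heatQuad_mul_heat {τ : ℝ} (hτ : 0 < τ) :
    ∫ x, heatQuad τ x * heat τ x = 0 :=
  integral_eq_zero_of_hasDerivAt_of_integrable (hasDerivAt_heatDeriv hτ)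
    (integrable_heatQuad_mul_heat hτ) (integrable_heatDeriv hτ)

lemma integral_mul_heat {τ : ℝ} (hτ : 0 < τ) : ∫ x, x * heat τ x = 0 := by
  have h := integral_heatDeriv hτ
  have h2 : ∀ x, x * heat τ x = -τ * heatDeriv τ x := fun x => by
    simp only [heatDeriv]; field_simp
  simp only [h2, integral_const_mul, h, mul_zero]

lemma integral_sq_mul_heat {τ : ℝ} (hτ : 0 < τ) : ∫ x, x ^ 2 * heat τ x = τ := by
  have h := integral_heatQuad_mul_heat hτ
  have h2 : ∀ x, x ^ 2 * heat τ x = τ ^ 2 * (heatQuad τ x * heat τ x) + τ * heat τ x := fun x => by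
    simp only [heatQuad]; field_simp; ring
  simp only [h2]
  rw [integral_add ((integrable_heatQuad_mul_heat hτ).const_mul _)
    ((integrable_heat hτ).const_mul _),
    integral_const_mul, integral_const_mul, h, integral_heat hτ]
  ring

/-- Integral of a quadratic polynomial against a translated heat kernel. -/
lemma integral_quadratic_mul_heat {τ : ℝ} (hτ : 0 < τ) (c₀ c₁ c₂ μ : ℝ) :
    ∫ z, (c₀ + c₁ * (z - μ) + c₂ * (z - μ) ^ 2) * heat τ (z - μ) = c₀ + c₂ * τ := by
  rw [integral_sub_right_eq_self (fun z => (c₀ + c₁ * z + c₂ * z ^ 2) * heat τ z) μ]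
  have e : ∀ z, (c₀ + c₁ * z + c₂ * z ^ 2) * heat τ z =
      c₀ * heat τ z + c₁ * (z * heat τ z) + c₂ * (z ^ 2 * heat τ z) := fun z => by ring
  have i0 := (integrable_heat hτ).const_mul c₀
  have i1 : Integrable fun z => c₁ * (z * heat τ z) := by
    simpa using (integrable_pow_mul_heat hτ 1).const_mul c₁
  have i2 := (integrable_pow_mul_heat hτ 2).const_mul c₂
  simp only [e]
  rw [integral_add (f := fun z => c₀ * heat τ z + c₁ * (z * heat τ z)) (i0.add i1) i2,
    integral_add i0 i1]
  simp only [integral_const_mul, integral_heat hτ, integral_mul_heat hτ, integral_sq_mul_heat hτ]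
  ring

/-- The product of two Gaussian densities, written as a product of independent Gaussians. -/
lemma heat_mul_heat {α β : ℝ} (hα : 0 < α) (hβ : 0 < β) (v w : ℝ) :
    heat α w * heat β (v - w) =
      heat (α + β) v * heat (α * β / (α + β)) (w - α * v / (α + β)) := by
  have hp := Real.pi_pos
  simp only [heat]
  rw [mul_mul_mul_comm, ← Real.exp_add, mul_mul_mul_comm, ← Real.exp_add, ← mul_inv, ← mul_inv,
    ← Real.sqrt_mul (by positivity), ← Real.sqrt_mul (by positivity)]
  congr 2
  · congr 1; field_simp
  · field_simp
    ring

/-- The first derivative of the heat kernel is smoothed by half of the time. -/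
lemma integral_heatDeriv_mul_heat {τ : ℝ} (hτ : 0 < τ) (x y : ℝ) :
    ∫ z, heatDeriv (τ / 2) (x - z) * (1 * heat (τ / 2) (z - y)) = heatDeriv τ (x - y) := by
  have e : ∀ z, heatDeriv (τ / 2) (x - z) * (1 * heat (τ / 2) (z - y)) =
      heat τ (x - y) * ((-((x - y) / τ) + 2 / τ * (z - (x + y) / 2) + 0 * (z - (x + y) / 2) ^ 2) *
        heat (τ / 4) (z - (x + y) / 2)) := fun z => by
    have h := heat_mul_heat (half_pos hτ) (half_pos hτ) (x - y) (x - z)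
    rw [show x - y - (x - z) = z - y by ring, show τ / 2 + τ / 2 = τ by ring,
      show x - z - τ / 2 * (x - y) / τ = -(z - (x + y) / 2) by field_simp; ring, heat_neg,
      show τ / 2 * (τ / 2) / τ = τ / 4 by field_simp; ring] at h
    simp only [heatDeriv]
    rw [show -((x - z) / (τ / 2)) * heat (τ / 2) (x - z) * (1 * heat (τ / 2) (z - y)) =
      -((x - z) / (τ / 2)) * (heat (τ / 2) (x - z) * heat (τ / 2) (z - y)) by ring, h]
    field_simp
    ring
  simp only [e]
  rw [integral_const_mul, integral_quadratic_mul_heat (by positivity)]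
  simp only [heatDeriv]; ring

/-- The second derivative of the heat kernel is a convolution of two first derivatives. -/
lemma integral_heatDeriv_mul_heatDeriv {τ : ℝ} (hτ : 0 < τ) (x y : ℝ) :
    ∫ z, heatDeriv (τ / 2) (x - z) * (-((z - y) / (τ / 2)) * heat (τ / 2) (z - y)) =
      heatQuad τ (x - y) * heat τ (x - y) := by
  have e : ∀ z, heatDeriv (τ / 2) (x - z) * (-((z - y) / (τ / 2)) * heat (τ / 2) (z - y)) =
      heat τ (x - y) * (((x - y) ^ 2 / τ ^ 2 + 0 * (z - (x + y) / 2)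
        + (-(4 / τ ^ 2)) * (z - (x + y) / 2) ^ 2) * heat (τ / 4) (z - (x + y) / 2)) := fun z => by
    have h := heat_mul_heat (half_pos hτ) (half_pos hτ) (x - y) (x - z)
    rw [show x - y - (x - z) = z - y by ring, show τ / 2 + τ / 2 = τ by ring,
      show x - z - τ / 2 * (x - y) / τ = -(z - (x + y) / 2) by field_simp; ring, heat_neg,
      show τ / 2 * (τ / 2) / τ = τ / 4 by field_simp; ring] at h
    simp only [heatDeriv]
    rw [show -((x - z) / (τ / 2)) * heat (τ / 2) (x - z) *
        (-((z - y) / (τ / 2)) * heat (τ / 2) (z - y)) =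
      (x - z) * (z - y) / (τ / 2) ^ 2 * (heat (τ / 2) (x - z) * heat (τ / 2) (z - y)) by
        field_simp, h]
    field_simp
    ring
  simp only [e]
  rw [integral_const_mul, integral_quadratic_mul_heat (by positivity)]
  simp only [heatQuad]; field_simp; ring

/-- The kernel of the energy form: a superposition over `z` of the rank one kernels
`heatDeriv (τ / 2) (x - z) * heatDeriv (τ / 2) (x' - z)` with nonnegative weights. -/
lemma integral_heatDeriv_heatDeriv_heat {τ : ℝ} (hτ : 0 < τ) (x x' y : ℝ) :
    ∫ z, heatDeriv (τ / 2) (x - z) * heatDeriv (τ / 2) (x' - z) * heat (3 * τ / 4) (z - y) =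
      heat τ (x - x') * heat τ ((x + x') / 2 - y) *
        (-heatQuad τ (x - x') + heatQuad τ ((x + x') / 2 - y) / 4) := by
  set m := (x + x') / 2 with hm
  set μ := m - (m - y) / 4 with hμ
  have e : ∀ z, heatDeriv (τ / 2) (x - z) * heatDeriv (τ / 2) (x' - z) * heat (3 * τ / 4) (z - y) =
      heat τ (x - x') * heat τ (m - y) *
      ((((m - y) ^ 2 / 16 - (x - x') ^ 2 / 4) * (4 / τ ^ 2) + (-(2 * (m - y) / τ ^ 2)) * (z - μ)
        + 4 / τ ^ 2 * (z - μ) ^ 2) * heat (3 * τ / 16) (z - μ)) := fun z => by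
    have h := heat_mul_heat (half_pos hτ) (half_pos hτ) (x - x') (x - z)
    rw [show x - x' - (x - z) = -(x' - z) by ring, heat_neg, show τ / 2 + τ / 2 = τ by ring,
      show x - z - τ / 2 * (x - x') / τ = m - z by rw [hm]; field_simp; ring,
      show τ / 2 * (τ / 2) / τ = τ / 4 by field_simp; ring] at h
    have h' := heat_mul_heat (α := τ / 4) (β := 3 * τ / 4) (by positivity) (by positivity)
      (m - y) (m - z)
    rw [show m - y - (m - z) = z - y by ring, show τ / 4 + 3 * τ / 4 = τ by ring,
      show m - z - τ / 4 * (m - y) / τ = -(z - μ) by rw [hμ]; field_simp; ring, heat_neg,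
      show τ / 4 * (3 * τ / 4) / τ = 3 * τ / 16 by field_simp; ring] at h'
    simp only [heatDeriv]
    rw [show -((x - z) / (τ / 2)) * heat (τ / 2) (x - z) *
        (-((x' - z) / (τ / 2)) * heat (τ / 2) (x' - z)) * heat (3 * τ / 4) (z - y) =
      (x - z) * (x' - z) / (τ / 2) ^ 2 * ((heat (τ / 2) (x - z) * heat (τ / 2) (x' - z)) *
        heat (3 * τ / 4) (z - y)) by field_simp, h, mul_assoc (heat τ (x - x')), h']
    rw [hμ, hm]
    field_simp
    ring
  simp only [e]
  rw [integral_const_mul, integral_quadratic_mul_heat (by positivity)]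
  simp only [heatQuad]; field_simp; ring

lemma heat_le_of_mem {a b τ : ℝ} (ha : 0 < a) (hτ : τ ∈ Set.Icc a b) (x : ℝ) :
    heat τ x ≤ √(b / a) * heat b x := by
  have hp := Real.pi_pos
  have hτ0 : 0 < τ := ha.trans_le hτ.1
  have hb : 0 < b := hτ0.trans_le hτ.2
  unfold heat
  rw [← mul_assoc]
  have h1 : (√(2 * Real.pi * τ))⁻¹ ≤ √(b / a) * (√(2 * Real.pi * b))⁻¹ := by
    rw [← Real.sqrt_inv, ← Real.sqrt_inv, ← Real.sqrt_mul (by positivity)]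
    apply Real.sqrt_le_sqrt
    rw [show b / a * (2 * Real.pi * b)⁻¹ = (2 * Real.pi * a)⁻¹ by field_simp]
    gcongr; exact hτ.1
  have h2 : -x ^ 2 / (2 * τ) ≤ -x ^ 2 / (2 * b) := by
    rw [neg_div, neg_div, neg_le_neg_iff]
    gcongr; exact hτ.2
  gcongr

/-- For times in a compact interval, the heat kernel and its second derivative are dominated by
one heat kernel. -/
lemma exists_one_add_heatQuad_mul_heat_le {a b : ℝ} (ha : 0 < a) (hab : a ≤ b) :
    ∃ C, 0 ≤ C ∧ ∀ τ ∈ Set.Icc a b, ∀ x, (1 + |heatQuad τ x|) * heat τ x ≤ C * heat (2 * b) x := by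
  have hp := Real.pi_pos
  have hb : 0 < b := ha.trans_le hab
  refine ⟨(1 + 1 / a + 4 * b / a ^ 2) * √(b / a) * √2, by positivity, fun τ hτ x => ?_⟩
  have hτ0 : 0 < τ := ha.trans_le hτ.1
  have h1 : |heatQuad τ x| ≤ x ^ 2 / a ^ 2 + 1 / a := by
    unfold heatQuad
    refine (abs_sub _ _).trans ?_
    rw [abs_of_nonneg (by positivity : 0 ≤ x ^ 2 / τ ^ 2),
      abs_of_nonneg (by positivity : 0 ≤ 1 / τ)]
    have := hτ.1
    gcongr
  have h2 := heat_le_of_mem ha hτ x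
  have h3 : heat b x = √2 * Real.exp (-(x ^ 2 / (4 * b))) * heat (2 * b) x := by
    unfold heat
    have : √2 * (√(2 * Real.pi * (2 * b)))⁻¹ = (√(2 * Real.pi * b))⁻¹ := by
      rw [show 2 * Real.pi * (2 * b) = 2 * (2 * Real.pi * b) by ring, Real.sqrt_mul (by positivity)]
      field_simp
    rw [← this, show -x ^ 2 / (2 * b) = -(x ^ 2 / (4 * b)) + -x ^ 2 / (2 * (2 * b)) by
      field_simp; ring, Real.exp_add]
    ring
  have h4 : (1 + (x ^ 2 / a ^ 2 + 1 / a)) * Real.exp (-(x ^ 2 / (4 * b))) ≤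
      1 + 1 / a + 4 * b / a ^ 2 := by
    set w := x ^ 2 / (4 * b) with hw
    have hw0 : 0 ≤ w := by positivity
    have e1 : Real.exp (-w) ≤ 1 := Real.exp_le_one_iff.2 (by linarith)
    have e2 : w * Real.exp (-w) ≤ 1 := by
      rw [Real.exp_neg, ← div_eq_mul_inv, div_le_one (Real.exp_pos _)]
      linarith [Real.add_one_le_exp w]
    have : x ^ 2 / a ^ 2 = 4 * b / a ^ 2 * w := by rw [hw]; field_simp
    rw [this]
    have : (1 + (4 * b / a ^ 2 * w + 1 / a)) * Real.exp (-w) =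
      (1 + 1 / a) * Real.exp (-w) + 4 * b / a ^ 2 * (w * Real.exp (-w)) := by ring
    rw [this]
    have i1 := mul_le_mul_of_nonneg_left e1 (by positivity : 0 ≤ 1 + 1 / a)
    have i2 := mul_le_mul_of_nonneg_left e2 (by positivity : 0 ≤ 4 * b / a ^ 2)
    linarith
  calc (1 + |heatQuad τ x|) * heat τ x
      ≤ (1 + (x ^ 2 / a ^ 2 + 1 / a)) * (√(b / a) * heat b x) := by
        have := heat_nonneg τ x
        gcongr
    _ = (1 + (x ^ 2 / a ^ 2 + 1 / a)) * Real.exp (-(x ^ 2 / (4 * b))) *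
          (√(b / a) * √2 * heat (2 * b) x) := by rw [h3]; ring
    _ ≤ (1 + 1 / a + 4 * b / a ^ 2) * (√(b / a) * √2 * heat (2 * b) x) := by
        have := heat_nonneg (2 * b) x
        gcongr
    _ = _ := by ring

/-! ### The energy of a function of one variable -/

/-- Smoothing of `q` by the derivative of the heat kernel of time `τ / 2`. -/
def heatDerivAvg (τ : ℝ) (q : ℝ → ℝ) (z : ℝ) : ℝ := ∫ x, q x * heatDeriv (τ / 2) (x - z)

/-- The kernel of the energy form, as a function of the difference and of the shifted midpoint. -/
def energyFactor (τ u m : ℝ) : ℝ := -heatQuad τ u + heatQuad τ m / 4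

lemma exists_abs_heatDeriv_le {τ : ℝ} (hτ : 0 < τ) : ∃ C, ∀ x, |heatDeriv τ x| ≤ C := by
  obtain ⟨C, hC0, hC⟩ := exists_one_add_heatQuad_mul_heat_le hτ le_rfl
  have hp := Real.pi_pos
  refine ⟨(1 + 1 / τ) * (C * (√(2 * Real.pi * (2 * τ)))⁻¹), fun x => ?_⟩
  have h1 := hC τ ⟨le_rfl, le_rfl⟩ x
  have h2 : heat (2 * τ) x ≤ (√(2 * Real.pi * (2 * τ)))⁻¹ := by
    unfold heat
    refine mul_le_of_le_one_right (by positivity) (Real.exp_le_one_iff.2 ?_)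
    rw [neg_div]; simp; positivity
  have h3 : |x / τ| ≤ (1 + 1 / τ) * (1 + |heatQuad τ x|) := by
    have a1 : heatQuad τ x = (x / τ) ^ 2 - 1 / τ := by unfold heatQuad; ring
    have a2 : (x / τ) ^ 2 ≤ |heatQuad τ x| + 1 / τ := by
      have := le_abs_self (heatQuad τ x); linarith
    have a3 : |x / τ| ≤ 1 + (x / τ) ^ 2 := by
      rw [← sq_abs]; nlinarith [sq_nonneg (|x / τ| - 1), abs_nonneg (x / τ)]
    have : 0 ≤ 1 / τ * |heatQuad τ x| := by positivity
    linarith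
  have h4 := heat_nonneg τ x
  calc |heatDeriv τ x| = |x / τ| * heat τ x := by
        rw [heatDeriv, abs_mul, abs_neg, abs_of_nonneg h4]
    _ ≤ (1 + 1 / τ) * (1 + |heatQuad τ x|) * heat τ x := by gcongr
    _ = (1 + 1 / τ) * ((1 + |heatQuad τ x|) * heat τ x) := by ring
    _ ≤ (1 + 1 / τ) * (C * heat (2 * τ) x) := by gcongr
    _ ≤ _ := by gcongr

lemma measurable_heatDerivAvg {τ : ℝ} {q : ℝ → ℝ} (hq : Measurable q) :
    Measurable (heatDerivAvg τ q) := by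
  have : StronglyMeasurable (Function.uncurry fun z x => q x * heatDeriv (τ / 2) (x - z)) := by
    apply Measurable.stronglyMeasurable
    unfold Function.uncurry; fun_prop
  exact this.integral_prod_right.measurable

lemma exists_abs_heatDerivAvg_le {τ : ℝ} (hτ : 0 < τ) {q : ℝ → ℝ} (hq : Integrable q) :
    ∃ C, ∀ z, |heatDerivAvg τ q z| ≤ C := by
  obtain ⟨C, hC⟩ := exists_abs_heatDeriv_le (half_pos hτ)
  refine ⟨∫ x, |q x| * C, fun z => ?_⟩
  rw [heatDerivAvg, ← Real.norm_eq_abs]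
  refine norm_integral_le_of_norm_le (hq.abs.mul_const C) (ae_of_all _ fun x => ?_)
  rw [Real.norm_eq_abs, abs_mul]
  gcongr
  exact hC _

/-- The energy form of `q` is a sum of squares. -/
lemma integral_energy {τ : ℝ} (hτ : 0 < τ) {q : ℝ → ℝ} (hq : Integrable q) (y : ℝ) :
    ∫ p : ℝ × ℝ, q p.1 * q p.2 * (heat τ (p.1 - p.2) * heat τ ((p.1 + p.2) / 2 - y) *
        energyFactor τ (p.1 - p.2) ((p.1 + p.2) / 2 - y)) =
      ∫ z, heatDerivAvg τ q z ^ 2 * heat (3 * τ / 4) (z - y) := by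
  obtain ⟨C, hC⟩ := exists_abs_heatDeriv_le (half_pos hτ)
  have hh : Integrable fun z => heat (3 * τ / 4) (z - y) :=
    (integrable_heat (by positivity)).comp_sub_right y
  have hint : Integrable (fun w : (ℝ × ℝ) × ℝ => q w.1.1 * q w.1.2 *
      (heatDeriv (τ / 2) (w.1.1 - w.2) * heatDeriv (τ / 2) (w.1.2 - w.2) *
        heat (3 * τ / 4) (w.2 - y))) (volume.prod volume) := by
    have h1 := ((hq.mul_prod hq).mul_prod hh).bdd_mul (c := C * C)
      (f := fun w : (ℝ × ℝ) × ℝ =>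
        heatDeriv (τ / 2) (w.1.1 - w.2) * heatDeriv (τ / 2) (w.1.2 - w.2))
      (Measurable.aestronglyMeasurable (by fun_prop)) (ae_of_all _ fun w => by
        rw [norm_mul]
        exact mul_le_mul (hC _) (hC _) (abs_nonneg _) ((abs_nonneg _).trans (hC 0)))
    refine h1.congr (ae_of_all _ fun w => ?_)
    simp only
    ring
  have e1 : ∀ p : ℝ × ℝ, q p.1 * q p.2 * (heat τ (p.1 - p.2) * heat τ ((p.1 + p.2) / 2 - y) *
        energyFactor τ (p.1 - p.2) ((p.1 + p.2) / 2 - y)) =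
      ∫ z, q p.1 * q p.2 * (heatDeriv (τ / 2) (p.1 - z) * heatDeriv (τ / 2) (p.2 - z) *
        heat (3 * τ / 4) (z - y)) := fun p => by
    rw [integral_const_mul, integral_heatDeriv_heatDeriv_heat hτ, energyFactor]
  simp only [e1]
  rw [integral_integral_swap hint]
  refine integral_congr_ae (ae_of_all _ fun z => ?_)
  simp only
  have e2 : ∀ p : ℝ × ℝ, q p.1 * q p.2 * (heatDeriv (τ / 2) (p.1 - z) *
      heatDeriv (τ / 2) (p.2 - z) * heat (3 * τ / 4) (z - y)) =
      (q p.1 * heatDeriv (τ / 2) (p.1 - z)) * (q p.2 * heatDeriv (τ / 2) (p.2 - z)) *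
        heat (3 * τ / 4) (z - y) := fun p => by ring
  simp only [e2]
  rw [integral_mul_const, Measure.volume_eq_prod,
    integral_prod_mul (fun x => q x * heatDeriv (τ / 2) (x - z))
      (fun x => q x * heatDeriv (τ / 2) (x - z))]
  simp only [heatDerivAvg]; ring

/-- The weighted Cauchy–Schwarz inequality. -/
lemma sq_integral_mul_le {α : Type*} [MeasurableSpace α] {μ : Measure α} {f g w : α → ℝ}
    (hw : ∀ a, 0 ≤ w a) (hf : Integrable (fun a => f a ^ 2 * w a) μ)
    (hg : Integrable (fun a => g a ^ 2 * w a) μ) (hfg : Integrable (fun a => f a * (g a * w a)) μ) :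
    (∫ a, f a * (g a * w a) ∂μ) ^ 2 ≤ (∫ a, f a ^ 2 * w a ∂μ) * ∫ a, g a ^ 2 * w a ∂μ := by
  have h : ∀ t : ℝ, 0 ≤ (∫ a, f a ^ 2 * w a ∂μ) * (t * t) +
      (-2 * ∫ a, f a * (g a * w a) ∂μ) * t + ∫ a, g a ^ 2 * w a ∂μ := fun t => by
    have e : ∫ a, (t * f a - g a) ^ 2 * w a ∂μ = (∫ a, f a ^ 2 * w a ∂μ) * (t * t) +
        (-2 * ∫ a, f a * (g a * w a) ∂μ) * t + ∫ a, g a ^ 2 * w a ∂μ := by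
      have e1 : ∀ a, (t * f a - g a) ^ 2 * w a = (f a ^ 2 * w a) * (t * t) +
        (f a * (g a * w a)) * (-2 * t) + g a ^ 2 * w a := fun a => by ring
      simp only [e1]
      rw [integral_add (f := fun a => (f a ^ 2 * w a) * (t * t) + (f a * (g a * w a)) * (-2 * t))
        ((hf.mul_const _).add (hfg.mul_const _)) hg,
        integral_add (hf.mul_const _) (hfg.mul_const _), integral_mul_const, integral_mul_const]
      ring
    rw [← e]
    exact integral_nonneg fun a => mul_nonneg (sq_nonneg _) (hw a)
  have := discrim_le_zero h
  simp only [discrim] at this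
  nlinarith

/-- If a kernel factors through the smoothed function, its action on `q` is controlled by the
energy of `q`. -/
lemma sq_integral_le_energy {τ : ℝ} (hτ : 0 < τ) {q : ℝ → ℝ} (hqm : Measurable q)
    (hq : Integrable q) (y : ℝ) {κ l : ℝ → ℝ}
    (hl1 : Integrable fun z => l z * heat (τ / 2) (z - y))
    (hl2 : Integrable fun z => l z ^ 2 * heat (τ / 2) (z - y))
    (hκ : ∀ x, ∫ z, heatDeriv (τ / 2) (x - z) * (l z * heat (τ / 2) (z - y)) = κ x) :
    (∫ x, q x * κ x) ^ 2 ≤ 5 / 4 * (∫ z, l z ^ 2 * heat (τ / 2) (z - y)) *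
      ∫ z, heatDerivAvg τ q z ^ 2 * heat (3 * τ / 4) (z - y) := by
  obtain ⟨C, hC⟩ := exists_abs_heatDeriv_le (half_pos hτ)
  obtain ⟨A, hA⟩ := exists_abs_heatDerivAvg_le hτ hq
  have hm := measurable_heatDerivAvg (τ := τ) hqm
  have hA0 : 0 ≤ A := (abs_nonneg _).trans (hA 0)
  have hint : Integrable (fun w : ℝ × ℝ => q w.1 * (heatDeriv (τ / 2) (w.1 - w.2) *
      (l w.2 * heat (τ / 2) (w.2 - y)))) (volume.prod volume) := by
    have h1 := (hq.mul_prod hl1).bdd_mul (c := C)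
      (f := fun w : ℝ × ℝ => heatDeriv (τ / 2) (w.1 - w.2))
      (Measurable.aestronglyMeasurable (by fun_prop)) (ae_of_all _ fun w => hC _)
    refine h1.congr (ae_of_all _ fun w => ?_)
    simp only
    ring
  have e1 : ∫ x, q x * κ x = ∫ z, heatDerivAvg τ q z * (l z * heat (τ / 2) (z - y)) := by
    have : ∀ x, q x * κ x = ∫ z, q x * (heatDeriv (τ / 2) (x - z) *
        (l z * heat (τ / 2) (z - y))) := fun x => by rw [integral_const_mul, hκ]
    simp only [this]
    rw [integral_integral_swap hint]
    refine integral_congr_ae (ae_of_all _ fun z => ?_)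
    simp only [← mul_assoc, integral_mul_const, heatDerivAvg]
  have hsq : ∀ {σ : ℝ}, 0 < σ → Integrable fun z => heatDerivAvg τ q z ^ 2 * heat σ (z - y) :=
    fun {σ} hσ => ((integrable_heat hσ).comp_sub_right y).bdd_mul (c := A ^ 2)
      (hm.pow_const 2).aestronglyMeasurable (ae_of_all _ fun z => by
        rw [norm_pow]; exact pow_le_pow_left₀ (abs_nonneg _) (hA z) 2)
  rw [e1]
  refine (sq_integral_mul_le (fun z => heat_nonneg _ _) (hsq (half_pos hτ)) hl2
    (hl1.bdd_mul (c := A) hm.aestronglyMeasurable (ae_of_all _ hA))).trans ?_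
  have h2 : ∫ z, heatDerivAvg τ q z ^ 2 * heat (τ / 2) (z - y) ≤
      5 / 4 * ∫ z, heatDerivAvg τ q z ^ 2 * heat (3 * τ / 4) (z - y) := by
    rw [← integral_const_mul]
    refine integral_mono (hsq (half_pos hτ)) ((hsq (by positivity)).const_mul _) fun z => ?_
    have h3 := heat_le_of_mem (half_pos hτ) (b := 3 * τ / 4) (τ := τ / 2)
      ⟨le_rfl, by linarith⟩ (z - y)
    have h4 : √(3 * τ / 4 / (τ / 2)) ≤ 5 / 4 := by
      rw [Real.sqrt_le_left (by norm_num)]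
      rw [show 3 * τ / 4 / (τ / 2) = 3 / 2 by field_simp; norm_num]; norm_num
    have h5 := heat_nonneg (3 * τ / 4) (z - y)
    calc heatDerivAvg τ q z ^ 2 * heat (τ / 2) (z - y)
        ≤ heatDerivAvg τ q z ^ 2 * (5 / 4 * heat (3 * τ / 4) (z - y)) := by
          gcongr; exact h3.trans (by gcongr)
      _ = _ := by ring
  have h6 : 0 ≤ ∫ z, l z ^ 2 * heat (τ / 2) (z - y) :=
    integral_nonneg fun z => mul_nonneg (sq_nonneg _) (heat_nonneg _ _)
  calc _ ≤ _ := mul_le_mul_of_nonneg_right h2 h6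
    _ = _ := by ring

lemma sq_integral_heatDeriv_le {τ : ℝ} (hτ : 0 < τ) {q : ℝ → ℝ} (hqm : Measurable q)
    (hq : Integrable q) (y : ℝ) :
    (∫ x, q x * heatDeriv τ (x - y)) ^ 2 ≤ 5 / 4 *
      ∫ z, heatDerivAvg τ q z ^ 2 * heat (3 * τ / 4) (z - y) := by
  have hh : Integrable fun z => heat (τ / 2) (z - y) :=
    (integrable_heat (half_pos hτ)).comp_sub_right y
  have h := sq_integral_le_energy hτ hqm hq y (κ := fun x => heatDeriv τ (x - y)) (l := fun _ => 1)
    (by simpa using hh) (by simpa using hh)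
    (fun x => integral_heatDeriv_mul_heat hτ x y)
  have h1 : ∫ z, heat (τ / 2) (z - y) = 1 := by
    rw [integral_sub_right_eq_self (heat (τ / 2)), integral_heat (half_pos hτ)]
  simpa [h1] using h

lemma sq_integral_heatQuad_le {τ : ℝ} (hτ : 0 < τ) {q : ℝ → ℝ} (hqm : Measurable q)
    (hq : Integrable q) (y : ℝ) :
    (∫ x, q x * (heatQuad τ (x - y) * heat τ (x - y))) ^ 2 ≤ 5 / 4 * (2 / τ) *
      ∫ z, heatDerivAvg τ q z ^ 2 * heat (3 * τ / 4) (z - y) := by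
  have e1 : ∀ z, (-((z - y) / (τ / 2))) ^ 2 * heat (τ / 2) (z - y) =
      4 / τ ^ 2 * ((z - y) ^ 2 * heat (τ / 2) (z - y)) := fun z => by field_simp; ring
  have i2 : Integrable fun z => (z - y) ^ 2 * heat (τ / 2) (z - y) :=
    (integrable_pow_mul_heat (half_pos hτ) 2).comp_sub_right y
  have h := sq_integral_le_energy hτ hqm hq y
    (κ := fun x => heatQuad τ (x - y) * heat τ (x - y)) (l := fun z => -((z - y) / (τ / 2)))
    ((integrable_heatDeriv (half_pos hτ)).comp_sub_right y)
    (by simp only [e1]; exact i2.const_mul _)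
    (fun x => integral_heatDeriv_mul_heatDeriv hτ x y)
  have h1 : ∫ z, (-((z - y) / (τ / 2))) ^ 2 * heat (τ / 2) (z - y) = 2 / τ := by
    simp only [e1]
    rw [integral_const_mul, integral_sub_right_eq_self (fun z => z ^ 2 * heat (τ / 2) z),
      integral_sq_mul_heat (half_pos hτ)]
    field_simp; norm_num
  rwa [h1] at h

/-! ### Doubled coordinates -/

/-- Selects from each pair `X j = (x, x')` the second entry if `j ∈ T` and the first otherwise. -/
def pick {m : ℕ} (T : Finset (Fin m)) (X : Fin m → ℝ × ℝ) : Fin m → ℝ :=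
  fun j => if j ∈ T then (X j).2 else (X j).1

/-- The Gaussian weight `∏ j, heat (v j) (x j - x' j)` on vectors of pairs. -/
def pairWeight {m : ℕ} (v : Fin m → ℝ) (X : Fin m → ℝ × ℝ) : ℝ :=
  ∏ j, heat (v j) ((X j).1 - (X j).2)

/-- The sum of the coordinates, where a coordinate in `J` is replaced by the midpoint of its
pair. -/
def center {m : ℕ} (J : Finset (Fin m)) (X : Fin m → ℝ × ℝ) : ℝ :=
  ∑ j, if j ∈ J then ((X j).1 + (X j).2) / 2 else (X j).1

/-- The variances of the pair weights: time `τ` for the coordinates in `J`. The second entries of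
the other pairs are dummy variables, integrated out against a Gaussian of variance `1`. -/
def doubledVar {m : ℕ} (J : Finset (Fin m)) (τ : ℝ) (j : Fin m) : ℝ := if j ∈ J then τ else 1

/-- The trace of a set of coordinates on the coordinates other than `k`. -/
def restr {m : ℕ} (k : Fin (m + 1)) (J : Finset (Fin (m + 1))) : Finset (Fin m) :=
  Finset.univ.filter fun l => k.succAbove l ∈ J

@[simp] lemma mem_restr {m : ℕ} {k : Fin (m + 1)} {J : Finset (Fin (m + 1))} {l : Fin m} :
    l ∈ restr k J ↔ k.succAbove l ∈ J := by simp [restr]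

lemma restr_insert {m : ℕ} (k : Fin (m + 1)) (J : Finset (Fin (m + 1))) :
    restr k (insert k J) = restr k J := by
  ext l; simp [Fin.succAbove_ne]

lemma doubledVar_pos {m : ℕ} (J : Finset (Fin m)) {τ : ℝ} (hτ : 0 < τ) (j : Fin m) :
    0 < doubledVar J τ j := by unfold doubledVar; split_ifs <;> positivity

lemma pairWeight_nonneg {m : ℕ} (v : Fin m → ℝ) (X : Fin m → ℝ × ℝ) : 0 ≤ pairWeight v X :=
  Finset.prod_nonneg fun _ _ => heat_nonneg _ _

lemma pick_insertNth {m : ℕ} (T : Finset (Fin (m + 1))) (k : Fin (m + 1)) (p : ℝ × ℝ)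
    (ω : Fin m → ℝ × ℝ) :
    pick T (k.insertNth p ω : Fin (m + 1) → ℝ × ℝ) =
      (k.insertNth (if k ∈ T then p.2 else p.1) (pick (restr k T) ω) : Fin (m + 1) → ℝ) := by
  funext j
  rcases Fin.eq_self_or_eq_succAbove k j with rfl | ⟨l, rfl⟩ <;> simp [pick]

lemma pairWeight_insertNth {m : ℕ} (J : Finset (Fin (m + 1))) (τ : ℝ) (k : Fin (m + 1))
    (p : ℝ × ℝ)
    (ω : Fin m → ℝ × ℝ) :
    pairWeight (doubledVar J τ) (k.insertNth p ω : Fin (m + 1) → ℝ × ℝ) =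
      heat (doubledVar J τ k) (p.1 - p.2) * pairWeight (doubledVar (restr k J) τ) ω := by
  simp [pairWeight, Fin.prod_univ_succAbove _ k, doubledVar]

lemma center_insertNth {m : ℕ} (J : Finset (Fin (m + 1))) (k : Fin (m + 1)) (p : ℝ × ℝ)
    (ω : Fin m → ℝ × ℝ) :
    center J (k.insertNth p ω : Fin (m + 1) → ℝ × ℝ) =
      (if k ∈ J then (p.1 + p.2) / 2 else p.1) + center (restr k J) ω := by
  simp [center, Fin.sum_univ_succAbove _ k]

@[fun_prop]
lemma measurable_pick {m : ℕ} (T : Finset (Fin m)) : Measurable (pick T) := by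
  refine measurable_pi_iff.2 fun j => ?_
  unfold pick; split_ifs <;> fun_prop

@[fun_prop]
lemma measurable_center {m : ℕ} (J : Finset (Fin m)) : Measurable (center J) := by
  unfold center
  refine Finset.measurable_sum _ fun j _ => ?_
  split_ifs <;> fun_prop

lemma measurable_pairWeight {m : ℕ} (v : Fin m → ℝ) : Measurable (pairWeight v) := by
  unfold pairWeight; fun_prop

/-- Fubini's theorem, separating the `k`-th pair of coordinates. -/
lemma integral_insertNth {E : Type*} [NormedAddCommGroup E] [NormedSpace ℝ E]
    {α : Type} [MeasureSpace α] [SigmaFinite (volume : Measure α)] {m : ℕ} (k : Fin (m + 1))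
    {f : (Fin (m + 1) → α) → E} (hf : Integrable f) :
    Integrable (fun w : (Fin m → α) × α => f (k.insertNth w.2 w.1)) (volume.prod volume) ∧
    ∫ X, f X = ∫ ω : Fin m → α, ∫ p : α, f (k.insertNth p ω) := by
  have h := (volume_preserving_piFinSuccAbove (fun _ : Fin (m + 1) => α) k).symm
  have h1 : Integrable (fun w : α × (Fin m → α) => f (k.insertNth w.1 w.2)) :=
    (h.integrable_comp_emb (MeasurableEquiv.measurableEmbedding _)).2 hf
  have h2 : Integrable (fun w : (Fin m → α) × α => f (k.insertNth w.2 w.1))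
    (volume.prod volume) := h1.swap
  refine ⟨h2, ?_⟩
  rw [← h.integral_comp']
  exact integral_prod_symm _ h1

lemma lintegral_insertNth {α : Type} [MeasureSpace α] [SigmaFinite (volume : Measure α)] {m : ℕ}
    (k : Fin (m + 1)) {f : (Fin (m + 1) → α) → ENNReal} (hf : Measurable f) :
    ∫⁻ X, f X = ∫⁻ ω : Fin m → α, ∫⁻ p : α, f (k.insertNth p ω) := by
  have h := (volume_preserving_piFinSuccAbove (fun _ : Fin (m + 1) => α) k).symm
  rw [← h.lintegral_comp hf]
  exact lintegral_prod_symm' _ (hf.comp (MeasurableEquiv.measurable _))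

lemma lintegral_heat {τ : ℝ} (hτ : 0 < τ) (c : ℝ) :
    ∫⁻ x, ENNReal.ofReal (heat τ (c - x)) = 1 := by
  rw [lintegral_sub_left_eq_self (fun x => ENNReal.ofReal (heat τ x)) c,
    ← ofReal_integral_eq_lintegral_ofReal (integrable_heat hτ) (ae_of_all _ (heat_nonneg τ)),
    integral_heat hτ, ENNReal.ofReal_one]

/-- Under the Gaussian pair weight, each selection of entries is distributed according to Lebesgue
measure. -/
lemma lintegral_comp_pick {m : ℕ} {v : Fin m → ℝ} (hv : ∀ j, 0 < v j) (T : Finset (Fin m))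
    {h : (Fin m → ℝ) → ENNReal} (hh : Measurable h) :
    ∫⁻ ω, h (pick T ω) * ENNReal.ofReal (pairWeight v ω) = ∫⁻ x, h x := by
  -- Exchanging the two entries of the pairs in `T` reduces the claim to `T = ∅`.
  set s : (Fin m → ℝ × ℝ) → Fin m → ℝ × ℝ :=
    fun ω l => (if l ∈ T then Prod.swap else id) (ω l) with hs
  have hsp : MeasurePreserving s volume volume := by
    refine volume_preserving_pi fun l => ?_
    split_ifs
    · exact Measure.measurePreserving_swap
    · exact MeasurePreserving.id _
  have hw : Measurable (pairWeight v) := measurable_pairWeight v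
  have e1 : ∀ ω, h (pick T ω) * ENNReal.ofReal (pairWeight v ω) =
      (fun ω' : Fin m → ℝ × ℝ => h (fun l => (ω' l).1) * ENNReal.ofReal (pairWeight v ω'))
      (s ω) := by
    intro ω
    simp only
    congr 2
    · funext l; simp only [pick, hs]; split_ifs <;> simp
    · refine Finset.prod_congr rfl fun l _ => ?_
      simp only [hs]
      split_ifs
      · rw [← heat_neg]; simp
      · rfl
  have hG : Measurable fun ω' : Fin m → ℝ × ℝ =>
      h (fun l => (ω' l).1) * ENNReal.ofReal (pairWeight v ω') :=
    (hh.comp (measurable_pi_iff.2 fun l => (measurable_pi_apply l).fst)).mul hw.ennreal_ofReal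
  refine (lintegral_congr e1).trans ((hsp.lintegral_comp hG).trans ?_)
  have hp := volume_measurePreserving_arrowProdEquivProdArrow ℝ ℝ (Fin m)
  have hM : Measurable fun w : (Fin m → ℝ) × (Fin m → ℝ) =>
      h w.1 * ENNReal.ofReal (∏ j, heat (v j) (w.1 j - w.2 j)) := by fun_prop
  refine (hp.lintegral_comp hM).trans ?_
  rw [Measure.volume_eq_prod, lintegral_prod _ hM.aemeasurable]
  refine lintegral_congr fun x => ?_
  simp only
  rw [lintegral_const_mul _ (by fun_prop)]
  have i1 : Integrable fun y : Fin m → ℝ => ∏ j, heat (v j) (x j - y j) :=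
    Integrable.fintype_prod (f := fun j y => heat (v j) (x j - y))
      fun j => (integrable_heat (hv j)).comp_sub_left (x j)
  rw [← ofReal_integral_eq_lintegral_ofReal i1
    (ae_of_all _ fun y => Finset.prod_nonneg fun j _ => heat_nonneg _ _),
    integral_fintype_prod_volume_eq_prod (fun j y => heat (v j) (x j - y))]
  have e2 : ∀ j, ∫ y, heat (v j) (x j - y) = 1 := fun j => by
    rw [integral_sub_left_eq_self (heat (v j)), integral_heat (hv j)]
  simp [e2]

/-- The Gaussian kernel of the form with doubled coordinates `J`. -/
def kernel {m : ℕ} (J : Finset (Fin m)) (τ : ℝ) (X : Fin m → ℝ × ℝ) : ℝ :=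
  pairWeight (doubledVar J τ) X * heat τ (center J X)

lemma kernel_nonneg {m : ℕ} (J : Finset (Fin m)) (τ : ℝ) (X : Fin m → ℝ × ℝ) :
    0 ≤ kernel J τ X := mul_nonneg (pairWeight_nonneg _ _) (heat_nonneg _ _)

@[fun_prop]
lemma measurable_kernel {m : ℕ} (J : Finset (Fin m)) {α : Type*} [MeasurableSpace α] {f : α → ℝ}
    {g : α → Fin m → ℝ × ℝ} (hf : Measurable f) (hg : Measurable g) :
    Measurable fun a => kernel J (f a) (g a) := by
  unfold kernel pairWeight
  have : ∀ j, Measurable fun a => doubledVar J (f a) j := fun j => by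
    unfold doubledVar; split_ifs <;> fun_prop
  fun_prop

/-- A function that does not depend on the undoubled coordinate `i` has the same integral against
the Gaussian kernel as against Lebesgue measure in the other coordinates. -/
lemma lintegral_removeNth_pick {m : ℕ} {J T : Finset (Fin (m + 1))} {i : Fin (m + 1)} (hi : i ∉ J)
    {τ : ℝ} (hτ : 0 < τ) {h : (Fin m → ℝ) → ENNReal} (hh : Measurable h) :
    ∫⁻ X, h (i.removeNth (pick T X)) * ENNReal.ofReal (kernel J τ X) = ∫⁻ x, h x := by
  have hr : Measurable fun x : Fin (m + 1) → ℝ => i.removeNth x :=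
    measurable_pi_iff.2 fun l => measurable_pi_apply _
  rw [lintegral_insertNth i (by fun_prop), ← lintegral_comp_pick (doubledVar_pos (restr i J) hτ)
    (restr i T) hh]
  refine lintegral_congr fun ω => ?_
  have e1 : ∀ p : ℝ × ℝ, h (i.removeNth (pick T (i.insertNth p ω : Fin (m + 1) → ℝ × ℝ))) *
      ENNReal.ofReal (kernel J τ (i.insertNth p ω : Fin (m + 1) → ℝ × ℝ)) =
      (h (pick (restr i T) ω) * ENNReal.ofReal (pairWeight (doubledVar (restr i J) τ) ω)) *
      (ENNReal.ofReal (heat τ (-center (restr i J) ω - p.1)) *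
        ENNReal.ofReal (heat 1 (p.1 - p.2))) := fun p => by
    rw [pick_insertNth, Fin.removeNth_insertNth, kernel, pairWeight_insertNth, center_insertNth,
      if_neg hi, doubledVar, if_neg hi, ← heat_neg τ (p.1 + _), neg_add, ← sub_eq_neg_add,
      ENNReal.ofReal_mul (mul_nonneg (heat_nonneg _ _) (pairWeight_nonneg _ _)),
      ENNReal.ofReal_mul (heat_nonneg _ _)]
    ring
  simp only [e1]
  rw [lintegral_const_mul _ (by fun_prop), Measure.volume_eq_prod, lintegral_prod _ (by fun_prop)]
  have e2 : ∀ x : ℝ, ∫⁻ y, ENNReal.ofReal (heat τ (-center (restr i J) ω - x)) *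
      ENNReal.ofReal (heat 1 (x - y)) = ENNReal.ofReal (heat τ (-center (restr i J) ω - x)) := by
    intro x
    rw [lintegral_const_mul _ (by fun_prop), lintegral_heat one_pos, mul_one]
  simp only [e2]
  rw [lintegral_heat hτ, mul_one]

/-! ### Test functions and Hölder's inequality -/

/-- Measurable functions that are bounded by `M` and vanish outside of the cube `[-M, M]ⁿ`. -/
structure IsTest {n : ℕ} {E : Type*} [NormedAddCommGroup E] [MeasurableSpace E] (M : ℝ)
    (f : (Fin n → ℝ) → E) : Prop where
  measurable : Measurable f
  norm_le : ∀ x, ‖f x‖ ≤ M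
  eq_zero : ∀ x l, M < |x l| → f x = 0

/-- Each `F i` has norm at most one in the Lebesgue space of exponent `1 / e i`. -/
def Normalized {n : ℕ} {E : Type*} [NormedAddCommGroup E] (e : Fin (n + 1) → ℝ)
    (F : Fin (n + 1) → (Fin n → ℝ) → E) : Prop :=
  ∀ i, ∫⁻ x, ENNReal.ofReal (‖F i x‖ ^ (1 / e i)) ≤ 1

/-- Hölder's inequality with respect to a measure with density `K`. It is enough to bound the
factors uniformly, because their weights `w` sum to one. -/
lemma lintegral_prod_mul_le {α ι : Type*} [MeasureSpace α] (s : Finset ι) {w : ι → ℝ}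
    (hw : ∀ q ∈ s, 0 < w q) (hw1 : ∑ q ∈ s, w q = 1) {g : ι → α → ℝ} (hg0 : ∀ q a, 0 ≤ g q a)
    (hgm : ∀ q ∈ s, Measurable (g q)) {K : α → ℝ} (hK : Measurable K) (hK0 : ∀ a, 0 ≤ K a)
    {c : ENNReal}
    (hg : ∀ q ∈ s, ∫⁻ a, ENNReal.ofReal (g q a ^ (1 / w q)) * ENNReal.ofReal (K a) ≤ c) :
    ∫⁻ a, ENNReal.ofReal ((∏ q ∈ s, g q a) * K a) ≤ c := by
  have h1 : ∀ a, ENNReal.ofReal ((∏ q ∈ s, g q a) * K a) ≤ ∑ q ∈ s, ENNReal.ofReal (w q) *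
      (ENNReal.ofReal (g q a ^ (1 / w q)) * ENNReal.ofReal (K a)) := fun a => by
    have h2 := Real.geom_mean_le_arith_mean_weighted s w (fun q => g q a ^ (1 / w q))
      (fun q hq => (hw q hq).le) hw1 (fun q _ => Real.rpow_nonneg (hg0 q a) _)
    have h3 : ∏ q ∈ s, (g q a ^ (1 / w q)) ^ w q = ∏ q ∈ s, g q a :=
      Finset.prod_congr rfl fun q hq => by
        rw [← Real.rpow_mul (hg0 q a), one_div_mul_cancel (hw q hq).ne', Real.rpow_one]
    rw [h3] at h2
    refine (ENNReal.ofReal_le_ofReal (mul_le_mul_of_nonneg_right h2 (hK0 a))).trans_eq ?_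
    rw [Finset.sum_mul, ENNReal.ofReal_sum_of_nonneg fun q hq => mul_nonneg (mul_nonneg
      (hw q hq).le (Real.rpow_nonneg (hg0 q a) _)) (hK0 a)]
    refine Finset.sum_congr rfl fun q hq => ?_
    rw [mul_assoc, ENNReal.ofReal_mul (hw q hq).le,
      ENNReal.ofReal_mul (Real.rpow_nonneg (hg0 q a) _)]
  have hm : ∀ q ∈ s, Measurable fun a => ENNReal.ofReal (g q a ^ (1 / w q)) *
      ENNReal.ofReal (K a) := fun q hq => by
    have := hgm q hq
    fun_prop
  calc ∫⁻ a, ENNReal.ofReal ((∏ q ∈ s, g q a) * K a)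
      ≤ ∫⁻ a, ∑ q ∈ s, ENNReal.ofReal (w q) *
          (ENNReal.ofReal (g q a ^ (1 / w q)) * ENNReal.ofReal (K a)) := lintegral_mono h1
    _ = ∑ q ∈ s, ENNReal.ofReal (w q) *
          ∫⁻ a, ENNReal.ofReal (g q a ^ (1 / w q)) * ENNReal.ofReal (K a) := by
        rw [lintegral_finsetSum _ fun q hq => (hm q hq).const_mul _]
        exact Finset.sum_congr rfl fun q hq => lintegral_const_mul _ (hm q hq)
    _ ≤ ∑ q ∈ s, ENNReal.ofReal (w q) * c := by gcongr with q hq; exact hg q hq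
    _ = c := by
        rw [← Finset.sum_mul, ← ENNReal.ofReal_sum_of_nonneg fun q hq => (hw q hq).le, hw1,
          ENNReal.ofReal_one, one_mul]

lemma measurable_removeNth {m : ℕ} (i : Fin (m + 1)) :
    Measurable fun x : Fin (m + 1) → ℝ => (i.removeNth x : Fin m → ℝ) :=
  measurable_pi_iff.2 fun _ => measurable_pi_apply _

/-- The product, over all functions `F i` with `i ∉ J` and over all choices of one entry from each
pair with index in `J`, of the values of `F i`. -/
def cubeProd {n : ℕ} (F : Fin (n + 1) → (Fin n → ℝ) → ℝ) (J : Finset (Fin (n + 1)))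
    (X : Fin (n + 1) → ℝ × ℝ) : ℝ :=
  ∏ i ∈ Jᶜ, ∏ T ∈ J.powerset, F i (i.removeNth (pick T X))

lemma measurable_cubeProd {n : ℕ} {F : Fin (n + 1) → (Fin n → ℝ) → ℝ}
    (hF : ∀ i, Measurable (F i)) (J : Finset (Fin (n + 1))) : Measurable (cubeProd F J) := by
  unfold cubeProd
  refine Finset.measurable_prod _ fun i _ => Finset.measurable_prod _ fun T _ => ?_
  exact (hF i).comp ((measurable_removeNth i).comp (measurable_pick T))

lemma lintegral_abs_cubeProd_le {n : ℕ} {F : Fin (n + 1) → (Fin n → ℝ) → ℝ}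
    (hF : ∀ i, Measurable (F i)) {e : Fin (n + 1) → ℝ} (he : ∀ i, 0 < e i) (hN : Normalized e F)
    {J : Finset (Fin (n + 1))} (hJ : 2 ^ J.card * ∑ i ∈ Jᶜ, e i = 1) {τ : ℝ} (hτ : 0 < τ) :
    ∫⁻ X, ENNReal.ofReal (|cubeProd F J X| * kernel J τ X) ≤ 1 := by
  have h := lintegral_prod_mul_le (Jᶜ ×ˢ J.powerset) (w := fun q => e q.1)
    (g := fun q X => |F q.1 (q.1.removeNth (pick q.2 X))|) (K := kernel J τ)
    (fun q _ => he q.1)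
    (by simp only [Finset.sum_product, Finset.sum_const, Finset.card_powerset, nsmul_eq_mul,
          ← Finset.mul_sum]
        exact_mod_cast hJ)
    (fun _ _ => abs_nonneg _)
    (fun q _ => ((hF q.1).comp ((measurable_removeNth q.1).comp (measurable_pick q.2))).abs)
    (by fun_prop) (kernel_nonneg J τ) (c := 1) (fun q hq => by
      have hq1 : q.1 ∉ J := by simpa using (Finset.mem_product.1 hq).1
      have := (hF q.1).abs
      rw [lintegral_removeNth_pick (h := fun x => ENNReal.ofReal (|F q.1 x| ^ (1 / e q.1))) hq1 hτ
        (by fun_prop)]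
      exact hN q.1)
  simpa only [Finset.prod_product, ← Finset.abs_prod, cubeProd] using h

/-- The square of the product of the values of a single `F k` is integrable against the pair
weight. -/
lemma lintegral_sq_prod_le {n : ℕ} {F : Fin (n + 1) → (Fin n → ℝ) → ℝ}
    (hF : ∀ i, Measurable (F i)) {e : Fin (n + 1) → ℝ} (he : ∀ i, 0 < e i) (hN : Normalized e F)
    {J : Finset (Fin (n + 1))} {k : Fin (n + 1)} (hk : 2 ^ (J.card + 1) * e k = 1)
    {v : Fin n → ℝ} (hv : ∀ j, 0 < v j) :
    ∫⁻ ω, ENNReal.ofReal ((∏ T ∈ J.powerset, F k (pick (restr k T) ω)) ^ 2 * pairWeight v ω)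
      ≤ 1 := by
  have h := lintegral_prod_mul_le J.powerset (w := fun _ => 2 * e k)
    (g := fun T ω => |F k (pick (restr k T) ω)| ^ 2) (K := pairWeight v)
    (fun q _ => by have := he k; positivity)
    (by simp only [Finset.sum_const, Finset.card_powerset, nsmul_eq_mul]
        push_cast; rw [← hk]; ring)
    (fun _ _ => sq_nonneg _)
    (fun T _ => ((hF k).comp (measurable_pick _)).abs.pow_const 2)
    (measurable_pairWeight v) (pairWeight_nonneg v) (c := 1) (fun T _ => by
      have := (hF k).abs
      have e1 : ∀ x, (|F k x| ^ 2) ^ (1 / (2 * e k)) = |F k x| ^ (1 / e k) := fun x => by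
        rw [← Real.rpow_natCast, ← Real.rpow_mul (abs_nonneg _)]
        congr 1
        have := (he k).ne'
        push_cast; field_simp
      simp only [e1]
      rw [lintegral_comp_pick hv (restr k T)
        (h := fun x => ENNReal.ofReal (|F k x| ^ (1 / e k))) (by fun_prop)]
      exact hN k)
  simpa only [Finset.prod_pow, ← Finset.abs_prod, sq_abs] using h

/-! ### Forms with Gaussian kernels -/

/-- A uniform majorant for the polynomial factors that occur in the time derivative of the
kernel. -/
def polyBound {m : ℕ} (J : Finset (Fin m)) (τ : ℝ) (X : Fin m → ℝ × ℝ) : ℝ :=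
  (∏ j ∈ J, (1 + |heatQuad τ ((X j).1 - (X j).2)|)) * (1 + |heatQuad τ (center J X)|)

lemma polyBound_mul_kernel_le {m : ℕ} (J : Finset (Fin m)) {a b : ℝ} (ha : 0 < a) (hab : a ≤ b) :
    ∃ C, ∀ τ ∈ Set.Icc a b, ∀ X, polyBound J τ X * kernel J τ X ≤ C * kernel J (2 * b) X := by
  obtain ⟨C, hC0, hC⟩ := exists_one_add_heatQuad_mul_heat_le ha hab
  refine ⟨(∏ j : Fin m, if j ∈ J then C else 1) * C, fun τ hτ X => ?_⟩
  have e1 : polyBound J τ X * kernel J τ X =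
      (∏ j, (if j ∈ J then 1 + |heatQuad τ ((X j).1 - (X j).2)| else 1) *
        heat (doubledVar J τ j) ((X j).1 - (X j).2)) *
      ((1 + |heatQuad τ (center J X)|) * heat τ (center J X)) := by
    rw [polyBound, kernel, pairWeight, Finset.prod_mul_distrib, Finset.prod_ite_mem,
      Finset.univ_inter]
    ring
  have e2 : (∏ j : Fin m, if j ∈ J then C else 1) * C * kernel J (2 * b) X =
      (∏ j, (if j ∈ J then C else 1) * heat (doubledVar J (2 * b) j) ((X j).1 - (X j).2)) *
      (C * heat (2 * b) (center J X)) := by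
    rw [kernel, pairWeight, Finset.prod_mul_distrib]; ring
  rw [e1, e2]
  refine mul_le_mul (Finset.prod_le_prod (fun j _ => ?_) fun j _ => ?_) (hC τ hτ _)
    (mul_nonneg (by positivity) (heat_nonneg _ _)) (Finset.prod_nonneg fun j _ => ?_)
  · refine mul_nonneg ?_ (heat_nonneg _ _)
    split_ifs <;> positivity
  · unfold doubledVar
    split_ifs
    · exact hC τ hτ _
    · exact le_rfl
  · refine mul_nonneg ?_ (heat_nonneg _ _)
    split_ifs <;> positivity

lemma one_le_prod_of_one_le {ι : Type*} {s : Finset ι} {f : ι → ℝ} (h : ∀ i ∈ s, 1 ≤ f i) :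
    1 ≤ ∏ i ∈ s, f i := by
  simpa using Finset.prod_le_prod (f := fun _ => (1 : ℝ)) (by simp) h

lemma one_le_polyBound {m : ℕ} (J : Finset (Fin m)) (τ : ℝ) (X : Fin m → ℝ × ℝ) :
    1 ≤ polyBound J τ X := by
  have h : ∀ j ∈ J, 1 ≤ 1 + |heatQuad τ ((X j).1 - (X j).2)| := fun j _ => by
    linarith [abs_nonneg (heatQuad τ ((X j).1 - (X j).2))]
  exact one_le_mul_of_one_le_of_one_le (one_le_prod_of_one_le h)
    (by linarith [abs_nonneg (heatQuad τ (center J X))])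

lemma abs_heatQuad_center_le {m : ℕ} (J : Finset (Fin m)) (τ : ℝ) (X : Fin m → ℝ × ℝ) :
    |heatQuad τ (center J X)| ≤ polyBound J τ X := by
  have h : ∀ j ∈ J, 1 ≤ 1 + |heatQuad τ ((X j).1 - (X j).2)| := fun j _ => by
    linarith [abs_nonneg (heatQuad τ ((X j).1 - (X j).2))]
  have h1 := one_le_prod_of_one_le h
  have := abs_nonneg (heatQuad τ (center J X))
  unfold polyBound; nlinarith

lemma abs_heatQuad_diff_le {m : ℕ} {J : Finset (Fin m)} (τ : ℝ) (X : Fin m → ℝ × ℝ) {j : Fin m}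
    (hj : j ∈ J) : |heatQuad τ ((X j).1 - (X j).2)| ≤ polyBound J τ X := by
  have h : ∀ i ∈ J.erase j, 1 ≤ 1 + |heatQuad τ ((X i).1 - (X i).2)| := fun i _ => by
    linarith [abs_nonneg (heatQuad τ ((X i).1 - (X i).2))]
  have h1 := one_le_prod_of_one_le h
  have h2 := abs_nonneg (heatQuad τ (center J X))
  have h3 := abs_nonneg (heatQuad τ ((X j).1 - (X j).2))
  unfold polyBound
  rw [← Finset.mul_prod_erase J _ hj]
  have h4 : 1 ≤ (∏ i ∈ J.erase j, (1 + |heatQuad τ ((X i).1 - (X i).2)|)) *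
    (1 + |heatQuad τ (center J X)|) := one_le_mul_of_one_le_of_one_le h1 (by linarith)
  rw [mul_assoc]
  nlinarith

/-- The form with kernel `kernel J τ * P τ`. -/
def form {n : ℕ} (F : Fin (n + 1) → (Fin n → ℝ) → ℝ) (J : Finset (Fin (n + 1)))
    (P : ℝ → (Fin (n + 1) → ℝ × ℝ) → ℝ) (τ : ℝ) : ℝ :=
  ∫ X, cubeProd F J X * (kernel J τ X * P τ X)

section Integrability

variable {n : ℕ} {F : Fin (n + 1) → (Fin n → ℝ) → ℝ} {e : Fin (n + 1) → ℝ}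
  {J : Finset (Fin (n + 1))}

lemma integrable_cubeProd_mul_kernel (hF : ∀ i, Measurable (F i)) (he : ∀ i, 0 < e i)
    (hN : Normalized e F) (hJ : 2 ^ J.card * ∑ i ∈ Jᶜ, e i = 1) {τ : ℝ} (hτ : 0 < τ) :
    Integrable fun X => |cubeProd F J X| * kernel J τ X := by
  have := measurable_cubeProd hF J
  refine ⟨Measurable.aestronglyMeasurable (by fun_prop), ?_⟩
  rw [hasFiniteIntegral_iff_ofReal (ae_of_all _ fun X =>
    mul_nonneg (abs_nonneg _) (kernel_nonneg _ _ _))]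
  exact (lintegral_abs_cubeProd_le hF he hN hJ hτ).trans_lt ENNReal.one_lt_top

lemma integral_abs_cubeProd_mul_kernel_le (hF : ∀ i, Measurable (F i)) (he : ∀ i, 0 < e i)
    (hN : Normalized e F) (hJ : 2 ^ J.card * ∑ i ∈ Jᶜ, e i = 1) {τ : ℝ} (hτ : 0 < τ) :
    ∫ X, |cubeProd F J X| * kernel J τ X ≤ 1 := by
  have h := lintegral_abs_cubeProd_le hF he hN hJ hτ
  rw [← ofReal_integral_eq_lintegral_ofReal (integrable_cubeProd_mul_kernel hF he hN hJ hτ)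
    (ae_of_all _ fun X => mul_nonneg (abs_nonneg _) (kernel_nonneg _ _ _))] at h
  exact ENNReal.ofReal_le_one.1 h

lemma integrable_form_prod (hF : ∀ i, Measurable (F i)) (he : ∀ i, 0 < e i)
    (hN : Normalized e F) (hJ : 2 ^ J.card * ∑ i ∈ Jᶜ, e i = 1) {a b : ℝ} (ha : 0 < a)
    (hab : a ≤ b) {P : ℝ → (Fin (n + 1) → ℝ × ℝ) → ℝ} (hP : Measurable (Function.uncurry P))
    {c : ℝ} (hc : ∀ τ ∈ Set.Icc a b, ∀ X, |P τ X| ≤ c * polyBound J τ X) :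
    Integrable (fun w : ℝ × (Fin (n + 1) → ℝ × ℝ) =>
      cubeProd F J w.2 * (kernel J w.1 w.2 * P w.1 w.2))
      ((volume.restrict (Set.Icc a b)).prod volume) := by
  obtain ⟨C, hC⟩ := polyBound_mul_kernel_le J ha hab
  have hm := measurable_cubeProd hF J
  have hP' : Measurable fun w : ℝ × (Fin (n + 1) → ℝ × ℝ) => P w.1 w.2 := hP
  have h1 : Integrable (fun w : ℝ × (Fin (n + 1) → ℝ × ℝ) =>
      (c * C) * (|cubeProd F J w.2| * kernel J (2 * b) w.2))
      ((volume.restrict (Set.Icc a b)).prod volume) :=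
    ((integrable_cubeProd_mul_kernel hF he hN hJ (by linarith : 0 < 2 * b)).comp_snd _).const_mul _
  refine h1.mono' (Measurable.aestronglyMeasurable (by fun_prop)) ?_
  have hc0 : 0 ≤ c := by
    have h2 := (abs_nonneg _).trans (hc a ⟨le_rfl, hab⟩ 0)
    have h3 := one_le_polyBound J a (0 : Fin (n + 1) → ℝ × ℝ)
    by_contra hneg
    nlinarith
  have hae : ∀ᵐ w ∂((volume.restrict (Set.Icc a b)).prod
      (volume : Measure (Fin (n + 1) → ℝ × ℝ))), w.1 ∈ Set.Icc a b :=
    Measure.quasiMeasurePreserving_fst.ae (ae_restrict_mem measurableSet_Icc)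
  filter_upwards [hae] with w hw
  rw [Real.norm_eq_abs, abs_mul, abs_mul, abs_of_nonneg (kernel_nonneg _ _ _)]
  have hk := kernel_nonneg J w.1 w.2
  calc |cubeProd F J w.2| * (kernel J w.1 w.2 * |P w.1 w.2|)
      ≤ |cubeProd F J w.2| * (kernel J w.1 w.2 * (c * polyBound J w.1 w.2)) := by
        gcongr; exact hc _ hw _
    _ = c * |cubeProd F J w.2| * (polyBound J w.1 w.2 * kernel J w.1 w.2) := by ring
    _ ≤ c * |cubeProd F J w.2| * (C * kernel J (2 * b) w.2) := by
        exact mul_le_mul_of_nonneg_left (hC _ hw _) (by positivity)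
    _ = _ := by ring

lemma integrable_form (hF : ∀ i, Measurable (F i)) (he : ∀ i, 0 < e i)
    (hN : Normalized e F) (hJ : 2 ^ J.card * ∑ i ∈ Jᶜ, e i = 1) {τ : ℝ} (hτ : 0 < τ)
    {P : (Fin (n + 1) → ℝ × ℝ) → ℝ} (hP : Measurable P)
    {c : ℝ} (hc : ∀ X, |P X| ≤ c * polyBound J τ X) :
    Integrable fun X => cubeProd F J X * (kernel J τ X * P X) := by
  obtain ⟨C, hC⟩ := polyBound_mul_kernel_le J hτ le_rfl
  have hm := measurable_cubeProd hF J
  refine ((integrable_cubeProd_mul_kernel hF he hN hJ (by linarith : 0 < 2 * τ)).const_mul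
    (c * C)).mono' (Measurable.aestronglyMeasurable (by fun_prop)) (ae_of_all _ fun X => ?_)
  have hc0 : 0 ≤ c := by
    have h2 := (abs_nonneg _).trans (hc 0)
    have h3 := one_le_polyBound J τ (0 : Fin (n + 1) → ℝ × ℝ)
    by_contra hneg
    nlinarith
  rw [Real.norm_eq_abs, abs_mul, abs_mul, abs_of_nonneg (kernel_nonneg _ _ _)]
  have hk := kernel_nonneg J τ X
  calc |cubeProd F J X| * (kernel J τ X * |P X|)
      ≤ |cubeProd F J X| * (kernel J τ X * (c * polyBound J τ X)) := by
        gcongr; exact hc _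
    _ = c * |cubeProd F J X| * (polyBound J τ X * kernel J τ X) := by ring
    _ ≤ c * |cubeProd F J X| * (C * kernel J (2 * τ) X) := by
        exact mul_le_mul_of_nonneg_left
          (hC _ ⟨le_rfl, le_rfl⟩ _) (by positivity)
    _ = _ := by ring

end Integrability

/-! ### The heat flow identity -/

/-- The logarithmic time derivative of `kernel J`. -/
def timePoly {m : ℕ} (J : Finset (Fin m)) (τ : ℝ) (X : Fin m → ℝ × ℝ) : ℝ :=
  (∑ j ∈ J, heatQuad τ ((X j).1 - (X j).2) + heatQuad τ (center J X)) / 2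

/-- The factor of the energy form in the direction `j`. -/
def energyPoly {m : ℕ} (J : Finset (Fin m)) (j : Fin m) (τ : ℝ) (X : Fin m → ℝ × ℝ) : ℝ :=
  energyFactor τ ((X j).1 - (X j).2) (center J X)

/-- The factor of the form with a cancellative kernel in the variable `center J`. -/
def centerPoly {m : ℕ} (J : Finset (Fin m)) (τ : ℝ) (X : Fin m → ℝ × ℝ) : ℝ :=
  heatQuad τ (center J X)

/-- The sum of all energies is a combination of the time derivative of the form and of the form
with kernel cancellative in `center J`. -/
lemma sum_energyPoly {m : ℕ} (J : Finset (Fin m)) (τ : ℝ) (X : Fin m → ℝ × ℝ) :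
    ∑ j ∈ J, energyPoly J j τ X = (1 + J.card / 4) * centerPoly J τ X - 2 * timePoly J τ X := by
  simp only [energyPoly, energyFactor, timePoly, centerPoly, Finset.sum_add_distrib,
    Finset.sum_neg_distrib, Finset.sum_const, nsmul_eq_mul]
  ring

lemma hasDerivAt_prod_of_log {ι : Type*} (s : Finset ι) {f : ι → ℝ → ℝ} {c : ι → ℝ} {τ : ℝ}
    (h : ∀ i ∈ s, HasDerivAt (f i) (c i * f i τ) τ) :
    HasDerivAt (fun t => ∏ i ∈ s, f i t) ((∑ i ∈ s, c i) * ∏ i ∈ s, f i τ) τ := by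
  classical
  induction s using Finset.induction_on with
  | empty => simpa using hasDerivAt_const τ (1 : ℝ)
  | insert i s hi ih =>
    have h1 := (h i (Finset.mem_insert_self i s)).fun_mul
      (ih fun j hj => h j (Finset.mem_insert_of_mem hj))
    simp only [Finset.prod_insert hi, Finset.sum_insert hi]
    convert! h1 using 1
    ring

lemma hasDerivAt_kernel {m : ℕ} (J : Finset (Fin m)) {τ : ℝ} (hτ : 0 < τ) (X : Fin m → ℝ × ℝ) :
    HasDerivAt (fun t => kernel J t X) (kernel J τ X * timePoly J τ X) τ := by
  have h1 : ∀ j ∈ (Finset.univ : Finset (Fin m)),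
      HasDerivAt (fun t => heat (doubledVar J t j) ((X j).1 - (X j).2))
        ((if j ∈ J then heatQuad τ ((X j).1 - (X j).2) / 2 else 0) *
          heat (doubledVar J τ j) ((X j).1 - (X j).2)) τ := fun j _ => by
    unfold doubledVar
    split_ifs
    · exact hasDerivAt_heat_var hτ _
    · simpa using hasDerivAt_const τ (heat 1 ((X j).1 - (X j).2))
  have h2 := (hasDerivAt_prod_of_log _ h1).fun_mul (hasDerivAt_heat_var hτ (center J X))
  unfold kernel pairWeight
  convert! h2 using 1
  rw [Finset.sum_ite_mem, Finset.univ_inter, ← Finset.sum_div, timePoly]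
  ring

lemma measurable_timePoly {m : ℕ} (J : Finset (Fin m)) :
    Measurable (Function.uncurry (timePoly J)) := by
  unfold Function.uncurry timePoly; fun_prop

lemma measurable_energyPoly {m : ℕ} (J : Finset (Fin m)) (j : Fin m) :
    Measurable (Function.uncurry (energyPoly J j)) := by
  unfold Function.uncurry energyPoly energyFactor; fun_prop

lemma measurable_centerPoly {m : ℕ} (J : Finset (Fin m)) :
    Measurable (Function.uncurry (centerPoly J)) := by
  unfold Function.uncurry centerPoly; fun_prop

lemma abs_timePoly_le {m : ℕ} (J : Finset (Fin m)) (τ : ℝ) (X : Fin m → ℝ × ℝ) :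
    |timePoly J τ X| ≤ (J.card + 1) * polyBound J τ X := by
  have h1 : |∑ j ∈ J, heatQuad τ ((X j).1 - (X j).2)| ≤ J.card * polyBound J τ X := by
    refine (Finset.abs_sum_le_sum_abs _ _).trans ?_
    rw [← nsmul_eq_mul]
    exact Finset.sum_le_card_nsmul _ _ _ fun j hj => abs_heatQuad_diff_le τ X hj
  have h2 := abs_heatQuad_center_le J τ X
  have h3 := one_le_polyBound J τ X
  have h4 : 0 ≤ (J.card + 1) * polyBound J τ X := by positivity
  rw [timePoly, abs_div, abs_two]
  have := abs_add_le (∑ j ∈ J, heatQuad τ ((X j).1 - (X j).2)) (heatQuad τ (center J X))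
  linarith

lemma abs_energyPoly_le {m : ℕ} {J : Finset (Fin m)} {j : Fin m} (hj : j ∈ J) (τ : ℝ)
    (X : Fin m → ℝ × ℝ) : |energyPoly J j τ X| ≤ 2 * polyBound J τ X := by
  have h1 := abs_heatQuad_diff_le τ X hj
  have h2 := abs_heatQuad_center_le J τ X
  rw [energyPoly, energyFactor]
  refine (abs_add_le _ _).trans ?_
  rw [abs_neg, abs_div, abs_of_pos (by norm_num : (0 : ℝ) < 4)]
  linarith [abs_nonneg (heatQuad τ (center J X))]

lemma abs_centerPoly_le {m : ℕ} (J : Finset (Fin m)) (τ : ℝ) (X : Fin m → ℝ × ℝ) :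
    |centerPoly J τ X| ≤ 1 * polyBound J τ X := by
  rw [one_mul]; exact abs_heatQuad_center_le J τ X

lemma integral_kernel_mul_timePoly {m : ℕ} (J : Finset (Fin m)) {a b : ℝ} (ha : 0 < a)
    (hab : a ≤ b) (X : Fin m → ℝ × ℝ) :
    ∫ τ in Set.Icc a b, kernel J τ X * timePoly J τ X = kernel J b X - kernel J a X := by
  rw [integral_Icc_eq_integral_Ioc, ← intervalIntegral.integral_of_le hab]
  refine intervalIntegral.integral_eq_sub_of_hasDerivAt (f := fun t => kernel J t X)
    (fun τ hτ => ?_) ?_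
  · rw [Set.uIcc_of_le hab] at hτ
    exact hasDerivAt_kernel J (ha.trans_le hτ.1) X
  · obtain ⟨C, hC⟩ := polyBound_mul_kernel_le J ha hab
    have hm : Measurable fun τ => timePoly J τ X := by unfold timePoly; fun_prop
    rw [intervalIntegrable_iff_integrableOn_Icc_of_le hab]
    refine Measure.integrableOn_of_bounded (M := (J.card + 1) * (C * kernel J (2 * b) X))
      (by simp) (Measurable.aestronglyMeasurable (by fun_prop))
      ((ae_restrict_mem measurableSet_Icc).mono fun τ hτ => ?_)
    rw [norm_mul, Real.norm_eq_abs, Real.norm_eq_abs, abs_of_nonneg (kernel_nonneg _ _ _)]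
    have h1 := abs_timePoly_le J τ X
    have h2 := hC τ hτ X
    have h3 := kernel_nonneg J τ X
    calc kernel J τ X * |timePoly J τ X|
        ≤ kernel J τ X * ((J.card + 1) * polyBound J τ X) := mul_le_mul_of_nonneg_left h1 h3
      _ = (J.card + 1) * (polyBound J τ X * kernel J τ X) := by ring
      _ ≤ _ := mul_le_mul_of_nonneg_left h2 (by positivity)

section

variable {n : ℕ} {F : Fin (n + 1) → (Fin n → ℝ) → ℝ} {e : Fin (n + 1) → ℝ}
  {J : Finset (Fin (n + 1))}

lemma integrable_form_time (hF : ∀ i, Measurable (F i)) (he : ∀ i, 0 < e i)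
    (hN : Normalized e F) (hJ : 2 ^ J.card * ∑ i ∈ Jᶜ, e i = 1) {a b : ℝ} (ha : 0 < a)
    (hab : a ≤ b) {P : ℝ → (Fin (n + 1) → ℝ × ℝ) → ℝ} (hP : Measurable (Function.uncurry P))
    {c : ℝ} (hc : ∀ τ ∈ Set.Icc a b, ∀ X, |P τ X| ≤ c * polyBound J τ X) :
    Integrable (form F J P) (volume.restrict (Set.Icc a b)) :=
  (integrable_form_prod hF he hN hJ ha hab hP hc).integral_prod_left

/-- The time derivative of the form with kernel `kernel J` has bounded integral, by the fundamental
theorem of calculus and Hölder's inequality. -/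
lemma abs_integral_form_timePoly_le (hF : ∀ i, Measurable (F i)) (he : ∀ i, 0 < e i)
    (hN : Normalized e F) (hJ : 2 ^ J.card * ∑ i ∈ Jᶜ, e i = 1) {a b : ℝ} (ha : 0 < a)
    (hab : a ≤ b) :
    |∫ τ in Set.Icc a b, form F J (timePoly J) τ| ≤ 2 := by
  have h1 := integrable_form_prod hF he hN hJ ha hab (measurable_timePoly J)
    (c := J.card + 1) fun τ _ X => abs_timePoly_le J τ X
  have h2 : ∫ τ in Set.Icc a b, form F J (timePoly J) τ =
      ∫ X, cubeProd F J X * (kernel J b X - kernel J a X) := by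
    unfold form
    rw [integral_integral_swap h1]
    refine integral_congr_ae (ae_of_all _ fun X => ?_)
    simp only
    rw [integral_const_mul, integral_kernel_mul_timePoly J ha hab]
  have hb := ha.trans_le hab
  have i1 := integrable_cubeProd_mul_kernel hF he hN hJ ha
  have i2 := integrable_cubeProd_mul_kernel hF he hN hJ hb
  rw [h2, ← Real.norm_eq_abs]
  refine (norm_integral_le_of_norm_le (i2.add i1) (ae_of_all _ fun X => ?_)).trans ?_
  · have k1 := kernel_nonneg J a X
    have k2 := kernel_nonneg J b X
    simp only [Pi.add_apply]
    rw [norm_mul, ← mul_add, Real.norm_eq_abs, Real.norm_eq_abs]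
    gcongr
    refine (abs_sub _ _).trans ?_
    rw [abs_of_nonneg k1, abs_of_nonneg k2]
  · simp only [Pi.add_apply]
    rw [integral_add i2 i1]
    linarith [integral_abs_cubeProd_mul_kernel_le hF he hN hJ ha,
      integral_abs_cubeProd_mul_kernel_le hF he hN hJ hb]

/-- If the energy forms in all directions `j ∈ J` are nonnegative, then the time integral of each
of them is controlled by that of the form with kernel cancellative in `center J`. -/
lemma integral_energy_le (hF : ∀ i, Measurable (F i)) (he : ∀ i, 0 < e i)
    (hN : Normalized e F) (hJ : 2 ^ J.card * ∑ i ∈ Jᶜ, e i = 1) {a b : ℝ} (ha : 0 < a)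
    (hab : a ≤ b) (hpos : ∀ j ∈ J, ∀ τ, 0 < τ → 0 ≤ form F J (energyPoly J j) τ)
    {k : Fin (n + 1)} (hk : k ∈ J) :
    ∫ τ in Set.Icc a b, form F J (energyPoly J k) τ ≤
      4 + (1 + J.card / 4) * ∫ τ in Set.Icc a b, |form F J (centerPoly J) τ| := by
  have iE : ∀ j ∈ J, Integrable (form F J (energyPoly J j)) (volume.restrict (Set.Icc a b)) :=
    fun j hj => integrable_form_time hF he hN hJ ha hab (measurable_energyPoly J j)
      fun τ _ X => abs_energyPoly_le hj τ X
  have iC : Integrable (form F J (centerPoly J)) (volume.restrict (Set.Icc a b)) :=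
    integrable_form_time hF he hN hJ ha hab (measurable_centerPoly J)
      fun τ _ X => abs_centerPoly_le J τ X
  have iT : Integrable (form F J (timePoly J)) (volume.restrict (Set.Icc a b)) :=
    integrable_form_time hF he hN hJ ha hab (measurable_timePoly J)
      fun τ _ X => abs_timePoly_le J τ X
  have hsum : ∀ τ ∈ Set.Icc a b, ∑ j ∈ J, form F J (energyPoly J j) τ =
      (1 + J.card / 4) * form F J (centerPoly J) τ - 2 * form F J (timePoly J) τ := by
    intro τ hτ
    have hτ0 := ha.trans_le hτ.1
    have m : ∀ {P : ℝ → (Fin (n + 1) → ℝ × ℝ) → ℝ}, Measurable (Function.uncurry P) →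
      Measurable (P τ) := fun hP => hP.comp (measurable_const.prodMk measurable_id)
    unfold form
    rw [← integral_finsetSum _ fun j hj => integrable_form hF he hN hJ hτ0
      (m (measurable_energyPoly J j)) (abs_energyPoly_le hj τ), ← integral_const_mul,
      ← integral_const_mul, ← integral_sub
        ((integrable_form hF he hN hJ hτ0 (m (measurable_centerPoly J))
          (abs_centerPoly_le J τ)).const_mul _)
        ((integrable_form hF he hN hJ hτ0 (m (measurable_timePoly J))
          (abs_timePoly_le J τ)).const_mul _)]
    refine integral_congr_ae (ae_of_all _ fun X => ?_)
    simp only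
    rw [← Finset.mul_sum, ← Finset.mul_sum, sum_energyPoly]
    ring
  have h1 : ∫ τ in Set.Icc a b, form F J (energyPoly J k) τ ≤
      ∫ τ in Set.Icc a b, ∑ j ∈ J, form F J (energyPoly J j) τ := by
    refine setIntegral_mono_on (iE k hk) (integrable_finsetSum _ iE) measurableSet_Icc
      fun τ hτ => ?_
    exact Finset.single_le_sum (f := fun j => form F J (energyPoly J j) τ)
      (fun j hj => hpos j hj τ (ha.trans_le hτ.1)) hk
  have h2 : ∫ τ in Set.Icc a b, ∑ j ∈ J, form F J (energyPoly J j) τ =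
      (1 + J.card / 4) * (∫ τ in Set.Icc a b, form F J (centerPoly J) τ) -
        2 * ∫ τ in Set.Icc a b, form F J (timePoly J) τ := by
    rw [setIntegral_congr_fun measurableSet_Icc hsum,
      integral_sub (iC.const_mul _) (iT.const_mul _), integral_const_mul, integral_const_mul]
  have h3 := abs_integral_form_timePoly_le hF he hN hJ ha hab
  have h4 : ∫ τ in Set.Icc a b, form F J (centerPoly J) τ ≤
      ∫ τ in Set.Icc a b, |form F J (centerPoly J) τ| :=
    integral_mono iC iC.abs fun τ => le_abs_self _
  have h5 := neg_abs_le (∫ τ in Set.Icc a b, form F J (timePoly J) τ)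
  have h6 : (1 + (J.card : ℝ) / 4) * ∫ τ in Set.Icc a b, form F J (centerPoly J) τ ≤
      (1 + J.card / 4) * ∫ τ in Set.Icc a b, |form F J (centerPoly J) τ| := by gcongr
  linarith

end

/-! ### Doubling one more coordinate -/

/-- The part of `cubeProd F J` that depends on the undoubled coordinate `k`, as a function of that
coordinate `x` and of the other pairs `ω`. -/
def sliceProd {n : ℕ} (F : Fin (n + 1) → (Fin n → ℝ) → ℝ) (J : Finset (Fin (n + 1)))
    (k : Fin (n + 1)) (ω : Fin n → ℝ × ℝ) (x : ℝ) : ℝ :=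
  ∏ i ∈ (insert k J)ᶜ, ∏ T ∈ J.powerset,
    F i (i.removeNth (k.insertNth x (pick (restr k T) ω) : Fin (n + 1) → ℝ))

section

variable {n : ℕ} {F : Fin (n + 1) → (Fin n → ℝ) → ℝ} {e : Fin (n + 1) → ℝ}
  {J : Finset (Fin (n + 1))} {k : Fin (n + 1)}

lemma cubeProd_insertNth (hk : k ∉ J) (p : ℝ × ℝ) (ω : Fin n → ℝ × ℝ) :
    cubeProd F J (k.insertNth p ω : Fin (n + 1) → ℝ × ℝ) =
      (∏ T ∈ J.powerset, F k (pick (restr k T) ω)) * sliceProd F J k ω p.1 := by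
  have h1 : Jᶜ = insert k (insert k J)ᶜ := by
    ext i; by_cases h : i = k <;> simp_all
  have h2 : ∀ T ∈ J.powerset, k ∉ T := fun T hT h => hk (Finset.mem_powerset.1 hT h)
  rw [cubeProd, h1, Finset.prod_insert (by simp), sliceProd]
  congr 1
  · refine Finset.prod_congr rfl fun T hT => ?_
    rw [pick_insertNth, Fin.removeNth_insertNth]
  · refine Finset.prod_congr rfl fun i _ => Finset.prod_congr rfl fun T hT => ?_
    rw [pick_insertNth, if_neg (h2 T hT)]

lemma cubeProd_insert_insertNth (hk : k ∉ J) (p : ℝ × ℝ) (ω : Fin n → ℝ × ℝ) :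
    cubeProd F (insert k J) (k.insertNth p ω : Fin (n + 1) → ℝ × ℝ) =
      sliceProd F J k ω p.1 * sliceProd F J k ω p.2 := by
  have h2 : ∀ T ∈ J.powerset, k ∉ T := fun T hT h => hk (Finset.mem_powerset.1 hT h)
  rw [cubeProd, sliceProd, sliceProd, ← Finset.prod_mul_distrib]
  refine Finset.prod_congr rfl fun i _ => ?_
  rw [Finset.prod_powerset_insert hk]
  congr 1
  · refine Finset.prod_congr rfl fun T hT => ?_
    rw [pick_insertNth, if_neg (h2 T hT)]
  · refine Finset.prod_congr rfl fun T hT => ?_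
    rw [pick_insertNth, if_pos (Finset.mem_insert_self k T), restr_insert]

lemma measurable_insertNth (k : Fin (n + 1)) :
    Measurable fun w : ℝ × (Fin n → ℝ) => (k.insertNth w.1 w.2 : Fin (n + 1) → ℝ) :=
  (MeasurableEquiv.piFinSuccAbove (fun _ => ℝ) k).symm.measurable

lemma measurable_sliceProd (hF : ∀ i, Measurable (F i)) (ω : Fin n → ℝ × ℝ) :
    Measurable (sliceProd F J k ω) := by
  unfold sliceProd
  refine Finset.measurable_prod _ fun i _ => Finset.measurable_prod _ fun T _ => ?_
  have h1 : Measurable fun x : ℝ => (k.insertNth x (pick (restr k T) ω) : Fin (n + 1) → ℝ) :=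
    (measurable_insertNth k).comp (measurable_prodMk_right (y := pick (restr k T) ω))
  exact (hF i).comp ((measurable_removeNth i).comp h1)

lemma abs_sliceProd_le {M : ℝ} (hF : ∀ i, IsTest M (F i)) (ω : Fin n → ℝ × ℝ) (x : ℝ) :
    |sliceProd F J k ω x| ≤ ∏ _i ∈ (insert k J)ᶜ, ∏ _T ∈ J.powerset, M := by
  unfold sliceProd
  simp only [Finset.abs_prod]
  exact Finset.prod_le_prod (fun i _ => Finset.prod_nonneg fun T _ => abs_nonneg _) fun i _ =>
    Finset.prod_le_prod (fun T _ => abs_nonneg _) fun T _ => (hF i).norm_le _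

lemma sliceProd_eq_zero {M : ℝ} (hF : ∀ i, IsTest M (F i)) (hne : (insert k J)ᶜ.Nonempty)
    (ω : Fin n → ℝ × ℝ) {x : ℝ} (hx : M < |x|) : sliceProd F J k ω x = 0 := by
  obtain ⟨i, hi⟩ := hne
  have hki : k ≠ i := by rintro rfl; simp at hi
  obtain ⟨l, rfl⟩ := Fin.exists_succAbove_eq hki
  refine Finset.prod_eq_zero hi (Finset.prod_eq_zero (Finset.empty_mem_powerset J) ?_)
  exact (hF i).eq_zero _ l (by simpa [Fin.removeNth] using hx)

lemma integrable_sliceProd {M : ℝ} (hF : ∀ i, IsTest M (F i)) (hne : (insert k J)ᶜ.Nonempty)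
    (ω : Fin n → ℝ × ℝ) : Integrable (sliceProd F J k ω) := by
  have hs : Function.support (sliceProd F J k ω) ⊆ Set.Icc (-M) M := fun x hx => by
    rw [Set.mem_Icc, ← abs_le]
    by_contra h
    exact hx (sliceProd_eq_zero hF hne ω (not_le.1 h))
  rw [← integrableOn_iff_integrable_of_support_subset hs]
  exact Measure.integrableOn_of_bounded (by simp)
    (measurable_sliceProd (fun i => (hF i).measurable) ω).aestronglyMeasurable
    (ae_of_all _ fun x => abs_sliceProd_le hF ω x)

/-- The energy of the slice of `cubeProd F J` in direction `k`. -/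
def sliceEnergy (F : Fin (n + 1) → (Fin n → ℝ) → ℝ) (J : Finset (Fin (n + 1))) (k : Fin (n + 1))
    (τ : ℝ) (ω : Fin n → ℝ × ℝ) : ℝ :=
  ∫ z, heatDerivAvg τ (sliceProd F J k ω) z ^ 2 *
    heat (3 * τ / 4) (z - -center (restr k J) ω)

lemma sliceEnergy_nonneg (τ : ℝ) (ω : Fin n → ℝ × ℝ) : 0 ≤ sliceEnergy F J k τ ω :=
  integral_nonneg fun _ => mul_nonneg (sq_nonneg _) (heat_nonneg _ _)

/-- The energy form in direction `k` is an average of the energies of the slices. -/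
lemma form_energyPoly_eq {M : ℝ} (hF : ∀ i, IsTest M (F i)) (he : ∀ i, 0 < e i)
    (hN : Normalized e F) (hJ : 2 ^ (insert k J).card * ∑ i ∈ (insert k J)ᶜ, e i = 1)
    (hne : (insert k J)ᶜ.Nonempty) (hk : k ∉ J) {τ : ℝ} (hτ : 0 < τ) :
    Integrable (fun ω => pairWeight (doubledVar (restr k J) τ) ω * sliceEnergy F J k τ ω) ∧
    form F (insert k J) (energyPoly (insert k J) k) τ =
      ∫ ω, pairWeight (doubledVar (restr k J) τ) ω * sliceEnergy F J k τ ω := by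
  have hF' := fun i => (hF i).measurable
  have hm : Measurable (energyPoly (insert k J) k τ) := by unfold energyPoly energyFactor; fun_prop
  obtain ⟨h1, h2⟩ := integral_insertNth k (integrable_form hF' he hN hJ hτ hm
    (abs_energyPoly_le (Finset.mem_insert_self k J) τ))
  have h3 : ∀ ω : Fin n → ℝ × ℝ, ∫ p : ℝ × ℝ,
      cubeProd F (insert k J) (k.insertNth p ω : Fin (n + 1) → ℝ × ℝ) *
        (kernel (insert k J) τ (k.insertNth p ω : Fin (n + 1) → ℝ × ℝ) *
          energyPoly (insert k J) k τ (k.insertNth p ω : Fin (n + 1) → ℝ × ℝ)) =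
      pairWeight (doubledVar (restr k J) τ) ω * sliceEnergy F J k τ ω := fun ω => by
    rw [sliceEnergy, ← integral_energy hτ (integrable_sliceProd hF hne ω), ← integral_const_mul]
    refine integral_congr_ae (ae_of_all _ fun p => ?_)
    simp only
    rw [cubeProd_insert_insertNth hk, kernel, pairWeight_insertNth, energyPoly, center_insertNth,
      if_pos (Finset.mem_insert_self k J), doubledVar, if_pos (Finset.mem_insert_self k J),
      restr_insert, Fin.insertNth_apply_same, sub_neg_eq_add]
    ring
  simp only [h3] at h2
  exact ⟨h1.integral_prod_left.congr (ae_of_all _ h3), h2⟩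

lemma form_energyPoly_nonneg {M : ℝ} (hF : ∀ i, IsTest M (F i)) (he : ∀ i, 0 < e i)
    (hN : Normalized e F) (hJ : 2 ^ J.card * ∑ i ∈ Jᶜ, e i = 1) (hne : Jᶜ.Nonempty) (hk : k ∈ J)
    {τ : ℝ} (hτ : 0 < τ) : 0 ≤ form F J (energyPoly J k) τ := by
  rw [← Finset.insert_erase hk] at hJ hne ⊢
  rw [(form_energyPoly_eq hF he hN hJ hne (Finset.notMem_erase k J) hτ).2]
  exact integral_nonneg fun ω => mul_nonneg (pairWeight_nonneg _ _) (sliceEnergy_nonneg _ _)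

lemma integral_mul_heat_one {f : ℝ → ℝ} (hf : Integrable f) :
    ∫ p : ℝ × ℝ, f p.1 * heat 1 (p.1 - p.2) = ∫ x, f x := by
  have h1 : Integrable (fun p : ℝ × ℝ => f p.1 * heat 1 (p.1 - p.2)) (volume.prod volume) := by
    have := (Integrable.convolution_integrand (ContinuousLinearMap.mul ℝ ℝ) hf
      (integrable_heat one_pos)).swap
    refine this.congr (ae_of_all _ fun p => ?_)
    simp only [Function.comp, Prod.fst_swap, Prod.snd_swap, ContinuousLinearMap.mul_apply']
    rw [← heat_neg 1 (p.1 - p.2), neg_sub]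
  rw [Measure.volume_eq_prod, integral_prod _ h1]
  refine integral_congr_ae (ae_of_all _ fun x => ?_)
  simp only
  rw [integral_const_mul, integral_sub_left_eq_self (heat 1), integral_heat one_pos, mul_one]

/-- Fubini's theorem for the form with kernel `κ = P * heat τ` in the variable `center J`,
separating the undoubled coordinate `k`. -/
lemma integral_center_eq {M : ℝ} (hF : ∀ i, IsTest M (F i)) (hk : k ∉ J) {τ : ℝ} {P : ℝ → ℝ}
    (hP : Integrable fun x => P x * heat τ x)
    (hint : Integrable fun X => cubeProd F J X * (kernel J τ X * P (center J X))) :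
    ∫ X, cubeProd F J X * (kernel J τ X * P (center J X)) =
      ∫ ω, pairWeight (doubledVar (restr k J) τ) ω *
        ((∏ T ∈ J.powerset, F k (pick (restr k T) ω)) *
          ∫ x, sliceProd F J k ω x * (P (x - -center (restr k J) ω) *
            heat τ (x - -center (restr k J) ω))) := by
  rw [(integral_insertNth k hint).2]
  refine integral_congr_ae (ae_of_all _ fun ω => ?_)
  simp only
  have hi : Integrable fun x => sliceProd F J k ω x * (P (x - -center (restr k J) ω) *
      heat τ (x - -center (restr k J) ω)) :=
    (hP.comp_sub_right (-center (restr k J) ω)).bdd_mul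
      (measurable_sliceProd (fun i => (hF i).measurable) ω).aestronglyMeasurable
      (ae_of_all _ fun x => abs_sliceProd_le hF ω x)
  rw [← integral_mul_heat_one hi, ← integral_const_mul, ← integral_const_mul]
  refine integral_congr_ae (ae_of_all _ fun p => ?_)
  simp only
  rw [cubeProd_insertNth hk, kernel, pairWeight_insertNth, center_insertNth, if_neg hk, doubledVar,
    if_neg hk, sub_neg_eq_add]
  ring

/-- Removing the function `F k`, which does not depend on the coordinate `k`, by the
Cauchy–Schwarz inequality in the other coordinates. The parameter `t` is free, to be optimized. -/
lemma abs_integral_center_le {M : ℝ} (hF : ∀ i, IsTest M (F i)) (he : ∀ i, 0 < e i)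
    (hN : Normalized e F) (hJ' : 2 ^ (insert k J).card * ∑ i ∈ (insert k J)ᶜ, e i = 1)
    (hek : 2 ^ (J.card + 1) * e k = 1)
    (hne : (insert k J)ᶜ.Nonempty) (hk : k ∉ J) {τ : ℝ} (hτ : 0 < τ)
    {P : ℝ → ℝ} (hP : Integrable fun x => P x * heat τ x)
    (hint : Integrable fun X => cubeProd F J X * (kernel J τ X * P (center J X))) {c : ℝ}
    (hc : ∀ q : ℝ → ℝ, Measurable q → Integrable q → ∀ y,
      (∫ x, q x * (P (x - y) * heat τ (x - y))) ^ 2 ≤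
        c * ∫ z, heatDerivAvg τ q z ^ 2 * heat (3 * τ / 4) (z - y)) {t : ℝ} (ht : 0 < t) :
    |∫ X, cubeProd F J X * (kernel J τ X * P (center J X))| ≤
      (t + c / t * form F (insert k J) (energyPoly (insert k J) k) τ) / 2 := by
  obtain ⟨hi, hE⟩ := form_energyPoly_eq hF he hN hJ' hne hk hτ
  have hv := doubledVar_pos (restr k J) hτ
  have hF' := fun i => (hF i).measurable
  set w := pairWeight (doubledVar (restr k J) τ) with hw
  set A : (Fin n → ℝ × ℝ) → ℝ := fun ω => ∏ T ∈ J.powerset, F k (pick (restr k T) ω) with hA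
  have hw0 : ∀ ω, 0 ≤ w ω := pairWeight_nonneg _
  have hwm : Measurable w := measurable_pairWeight _
  have hAm : Measurable A := Finset.measurable_prod _ fun T _ => (hF' k).comp (measurable_pick _)
  have hL : ∫⁻ ω, ENNReal.ofReal (A ω ^ 2 * w ω) ≤ 1 := lintegral_sq_prod_le hF' he hN hek hv
  have hA0 : ∀ ω, 0 ≤ A ω ^ 2 * w ω := fun ω => mul_nonneg (sq_nonneg _) (hw0 ω)
  have hAi : Integrable fun ω => A ω ^ 2 * w ω := by
    refine ⟨Measurable.aestronglyMeasurable (by fun_prop), ?_⟩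
    rw [hasFiniteIntegral_iff_ofReal (ae_of_all _ hA0)]
    exact hL.trans_lt ENNReal.one_lt_top
  have hA1 : ∫ ω, A ω ^ 2 * w ω ≤ 1 := by
    rw [← ofReal_integral_eq_lintegral_ofReal hAi (ae_of_all _ hA0)] at hL
    exact ENNReal.ofReal_le_one.1 hL
  rw [integral_center_eq hF hk hP hint, hE, ← Real.norm_eq_abs]
  refine (norm_integral_le_of_norm_le ((hAi.const_mul (t / 2)).add (hi.const_mul (c / t / 2)))
    (ae_of_all _ fun ω => ?_)).trans ?_
  · simp only [Pi.add_apply]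
    set H := ∫ x, sliceProd F J k ω x * (P (x - -center (restr k J) ω) *
            heat τ (x - -center (restr k J) ω)) with hH
    have h1 : H ^ 2 ≤ c * sliceEnergy F J k τ ω :=
      hc _ (measurable_sliceProd hF' ω) (integrable_sliceProd hF hne ω) _
    have h2 : |A ω * H| ≤ t / 2 * A ω ^ 2 + c / t / 2 * sliceEnergy F J k τ ω := by
      have h3 : |A ω| * |H| ≤ t / 2 * |A ω| ^ 2 + 1 / t / 2 * |H| ^ 2 := by
        have := sq_nonneg (t * |A ω| - |H|)
        rw [← sub_nonneg]
        have h4 : t / 2 * |A ω| ^ 2 + 1 / t / 2 * |H| ^ 2 - |A ω| * |H| =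
          (t * |A ω| - |H|) ^ 2 / (2 * t) := by field_simp; ring
        rw [h4]; positivity
      rw [abs_mul]
      rw [sq_abs, sq_abs] at h3
      have h5 : 1 / t / 2 * H ^ 2 ≤ 1 / t / 2 * (c * sliceEnergy F J k τ ω) := by gcongr
      calc _ ≤ _ := h3
        _ ≤ t / 2 * A ω ^ 2 + 1 / t / 2 * (c * sliceEnergy F J k τ ω) := by gcongr
        _ = _ := by ring
    rw [norm_mul, Real.norm_eq_abs, Real.norm_eq_abs, abs_of_nonneg (hw0 ω)]
    calc w ω * |A ω * H| ≤ w ω * (t / 2 * A ω ^ 2 + c / t / 2 * sliceEnergy F J k τ ω) :=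
          mul_le_mul_of_nonneg_left h2 (hw0 ω)
      _ = _ := by ring
  · simp only [Pi.add_apply]
    rw [integral_add (hAi.const_mul _) (hi.const_mul _), integral_const_mul, integral_const_mul]
    have : t / 2 * ∫ ω, A ω ^ 2 * w ω ≤ t / 2 * 1 := by gcongr
    linarith

/-- If only one coordinate is undoubled, then the form with kernel cancellative in `center J`
vanishes. -/
lemma form_centerPoly_eq_zero {i : Fin (n + 1)} (hF : ∀ i, Measurable (F i)) (he : ∀ i, 0 < e i)
    (hN : Normalized e F) (hJ : 2 ^ J.card * ∑ i ∈ Jᶜ, e i = 1) (hi : Jᶜ = {i}) {τ : ℝ}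
    (hτ : 0 < τ) : form F J (centerPoly J) τ = 0 := by
  have hm : Measurable (centerPoly J τ) := by unfold centerPoly; fun_prop
  have hiJ : i ∉ J := by rw [← Finset.mem_compl, hi]; exact Finset.mem_singleton_self i
  have hins : (insert i J)ᶜ = ∅ := by rw [Finset.compl_insert, hi]; simp
  rw [form, (integral_insertNth i (integrable_form hF he hN hJ hτ hm (abs_centerPoly_le J τ))).2]
  refine integral_eq_zero_of_ae (ae_of_all _ fun ω => ?_)
  have hQ : Integrable fun x => heatQuad τ (x - -center (restr i J) ω) *
      heat τ (x - -center (restr i J) ω) :=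
    (integrable_heatQuad_mul_heat hτ).comp_sub_right _
  have h0 : ∫ x, heatQuad τ (x - -center (restr i J) ω) *
      heat τ (x - -center (restr i J) ω) = 0 := by
    rw [integral_sub_right_eq_self (fun x => heatQuad τ x * heat τ x),
      integral_heatQuad_mul_heat hτ]
  have h1 : ∀ p : ℝ × ℝ, cubeProd F J (i.insertNth p ω : Fin (n + 1) → ℝ × ℝ) *
      (kernel J τ (i.insertNth p ω : Fin (n + 1) → ℝ × ℝ) *
        centerPoly J τ (i.insertNth p ω : Fin (n + 1) → ℝ × ℝ)) =
      ((∏ T ∈ J.powerset, F i (pick (restr i T) ω)) * pairWeight (doubledVar (restr i J) τ) ω) *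
      ((heatQuad τ (p.1 - -center (restr i J) ω) * heat τ (p.1 - -center (restr i J) ω)) *
        heat 1 (p.1 - p.2)) := fun p => by
    rw [cubeProd_insertNth hiJ, sliceProd, hins, kernel, pairWeight_insertNth, centerPoly,
      center_insertNth, if_neg hiJ, doubledVar, if_neg hiJ, sub_neg_eq_add, Finset.prod_empty]
    ring
  simp only [h1, Pi.zero_apply]
  rw [integral_const_mul, integral_mul_heat_one hQ, h0, mul_zero]

end

/-! ### Induction on the number of doubled coordinates -/

/-- The reciprocals of the exponents `2, 4, …, 2ⁿ, 2ⁿ`. -/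
def dyadicWeight (n : ℕ) (i : Fin (n + 1)) : ℝ :=
  if (i : ℕ) < n then (1 / 2) ^ ((i : ℕ) + 1) else (1 / 2) ^ n

/-- The first `k` coordinates. -/
def initialSet (n k : ℕ) : Finset (Fin (n + 1)) := Finset.univ.filter fun i => (i : ℕ) < k

lemma dyadicWeight_pos (n : ℕ) (i : Fin (n + 1)) : 0 < dyadicWeight n i := by
  unfold dyadicWeight; split_ifs <;> positivity

lemma mem_initialSet {n k : ℕ} {i : Fin (n + 1)} : i ∈ initialSet n k ↔ (i : ℕ) < k := by
  simp [initialSet]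

lemma notMem_initialSet {n k : ℕ} (hk : k < n + 1) : (⟨k, hk⟩ : Fin (n + 1)) ∉ initialSet n k := by
  simp [mem_initialSet]

lemma insert_initialSet {n k : ℕ} (hk : k < n + 1) :
    insert ⟨k, hk⟩ (initialSet n k) = initialSet n (k + 1) := by
  ext i
  simp only [Finset.mem_insert, mem_initialSet, Fin.ext_iff]
  omega

lemma card_initialSet {n k : ℕ} (hk : k ≤ n + 1) : (initialSet n k).card = k := by
  induction k with
  | zero => simp [initialSet]
  | succ k ih =>
    rw [← insert_initialSet hk, Finset.card_insert_of_notMem (notMem_initialSet hk),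
      ih (by omega)]

lemma compl_initialSet_self (n : ℕ) : (initialSet n n)ᶜ = {Fin.last n} := by
  ext i
  simp only [Finset.mem_compl, mem_initialSet, Finset.mem_singleton, Fin.ext_iff, Fin.val_last]
  have := i.2
  omega

lemma compl_initialSet_nonempty {n k : ℕ} (hk : k ≤ n) : (initialSet n k)ᶜ.Nonempty :=
  ⟨Fin.last n, by simp [mem_initialSet, hk]⟩

/-- The Hölder condition for the form in which the first `k` coordinates are doubled. -/
lemma two_pow_mul_sum_dyadicWeight {n k : ℕ} (hk : k ≤ n) :
    2 ^ (initialSet n k).card * ∑ i ∈ (initialSet n k)ᶜ, dyadicWeight n i = 1 := by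
  rw [card_initialSet (by omega)]
  induction hk using Nat.decreasingInduction with
  | self =>
    rw [compl_initialSet_self, Finset.sum_singleton, dyadicWeight, if_neg (by simp), ← mul_pow]
    norm_num
  | of_succ k hk ih =>
    have h1 : (initialSet n k)ᶜ =
        insert ⟨k, by omega⟩ (initialSet n (k + 1))ᶜ := by
      ext i
      simp only [Finset.mem_compl, Finset.mem_insert, mem_initialSet, Fin.ext_iff]
      omega
    rw [h1, Finset.sum_insert (by simp [mem_initialSet]), mul_add]
    have h2 : dyadicWeight n ⟨k, by omega⟩ = (1 / 2) ^ (k + 1) := by simp [dyadicWeight, hk]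
    have h3 : (2 : ℝ) ^ k * (1 / 2) ^ (k + 1) = 1 / 2 := by
      rw [pow_succ, ← mul_assoc, ← mul_pow]; norm_num
    rw [h2, h3]
    rw [pow_succ] at ih
    linarith

lemma two_pow_mul_dyadicWeight {n k : ℕ} (hk : k < n) :
    2 ^ ((initialSet n k).card + 1) * dyadicWeight n ⟨k, by omega⟩ = 1 := by
  rw [card_initialSet (by omega), dyadicWeight, if_pos hk, ← mul_pow]
  norm_num

lemma integral_one_div_Icc {a b : ℝ} (ha : 0 < a) (hab : a ≤ b) :
    IntegrableOn (fun τ => 1 / τ) (Set.Icc a b) ∧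
      ∫ τ in Set.Icc a b, 1 / τ = Real.log (b / a) := by
  constructor
  · refine ContinuousOn.integrableOn_Icc (continuousOn_const.div continuousOn_id fun τ hτ => ?_)
    exact (ha.trans_le hτ.1).ne'
  · rw [integral_Icc_eq_integral_Ioc, ← intervalIntegral.integral_of_le hab,
      integral_one_div_of_pos ha (ha.trans_le hab)]

/-- Half of the logarithmic gain for the energy is inherited by the form it controls. -/
lemma integral_le_of_energy {a b C δ : ℝ} (ha : 0 < a) (hab : a ≤ b)
    (hL : 1 ≤ Real.log (b / a)) {g E : ℝ → ℝ}
    (hE : IntegrableOn E (Set.Icc a b))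
    (hEC : ∫ τ in Set.Icc a b, E τ ≤ C * Real.log (b / a) ^ (1 - δ))
    (hg : ∀ s, 0 < s → ∀ τ ∈ Set.Icc a b, |g τ| ≤ (s * (1 / τ) + 5 / 2 / s * E τ) / 2) :
    ∫ τ in Set.Icc a b, |g τ| ≤ (1 + 5 / 2 * C) / 2 * Real.log (b / a) ^ (1 - δ / 2) := by
  set L := Real.log (b / a)
  have hL0 : 0 < L := by linarith
  obtain ⟨i1, i2⟩ := integral_one_div_Icc ha hab
  -- The two terms in `hg` balance for this choice of `s`.
  set s := L ^ (-(δ / 2)) with hs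
  have hs0 : 0 < s := Real.rpow_pos_of_pos hL0 _
  have h1 : ∫ τ in Set.Icc a b, |g τ| ≤
      ∫ τ in Set.Icc a b, (s * (1 / τ) + 5 / 2 / s * E τ) / 2 :=
    integral_mono_of_nonneg (ae_of_all _ fun τ => abs_nonneg _)
      (((i1.const_mul s).add (hE.const_mul _)).div_const 2)
      ((ae_restrict_mem measurableSet_Icc).mono (hg s hs0))
  have e1 : s * L = L ^ (1 - δ / 2) := by
    rw [hs, sub_eq_add_neg, add_comm, Real.rpow_add hL0, Real.rpow_one]
  have e2 : L ^ (1 - δ) = s * L ^ (1 - δ / 2) := by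
    rw [hs, ← Real.rpow_add hL0]; congr 1; ring
  rw [integral_div, integral_add (i1.const_mul s) (hE.const_mul _), integral_const_mul,
    integral_const_mul, i2, e1] at h1
  refine h1.trans ?_
  have h2 : 5 / 2 / s * ∫ τ in Set.Icc a b, E τ ≤ 5 / 2 / s * (C * (s * L ^ (1 - δ / 2))) := by
    rw [← e2]; gcongr
  have h3 : 5 / 2 / s * (C * (s * L ^ (1 - δ / 2))) = 5 / 2 * C * L ^ (1 - δ / 2) := by
    field_simp
  linarith

/-- The energies with the first `k` coordinates doubled have a power gain. The proof is by downward
induction on `k`, as the energy for `k` is controlled by the one for `k + 1`; for `k = n` the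
energies are bounded. -/
lemma exists_integral_energy_le {n k : ℕ} (hk : k ≤ n) :
    ∃ C δ : ℝ, 0 < δ ∧ δ ≤ 1 ∧ ∀ (M : ℝ) (F : Fin (n + 1) → (Fin n → ℝ) → ℝ),
      (∀ i, IsTest M (F i)) → Normalized (dyadicWeight n) F → ∀ a b : ℝ, 0 < a → a ≤ b →
        1 ≤ Real.log (b / a) → ∀ j ∈ initialSet n k,
          ∫ τ in Set.Icc a b, form F (initialSet n k) (energyPoly (initialSet n k) j) τ ≤
            C * Real.log (b / a) ^ (1 - δ) := by
  have he := dyadicWeight_pos n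
  induction hk using Nat.decreasingInduction with
  | self =>
    refine ⟨4, 1, one_pos, le_rfl, fun M F hF hN a b ha hab hL j hj => ?_⟩
    have hF' := fun i => (hF i).measurable
    have hJ := two_pow_mul_sum_dyadicWeight (le_refl n)
    have h1 := integral_energy_le hF' he hN hJ ha hab
      (fun j hj τ hτ => form_energyPoly_nonneg hF he hN hJ
        (compl_initialSet_nonempty le_rfl) hj hτ) hj
    have h2 : ∫ τ in Set.Icc a b, |form F (initialSet n n) (centerPoly (initialSet n n)) τ| =
        0 := by
      rw [setIntegral_congr_fun (g := fun _ => (0 : ℝ)) measurableSet_Icc fun τ hτ => ?_]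
      · simp
      · simp only
        rw [form_centerPoly_eq_zero hF' he hN hJ (compl_initialSet_self n) (ha.trans_le hτ.1),
          abs_zero]
    simpa [h2] using h1
  | of_succ k hk ih =>
    obtain ⟨C, δ, hδ0, hδ1, h⟩ := ih
    refine ⟨4 + (1 + k / 4) * ((1 + 5 / 2 * C) / 2), δ / 2, by positivity, by linarith,
      fun M F hF hN a b ha hab hL j hj => ?_⟩
    have hF' := fun i => (hF i).measurable
    have hkn : k < n + 1 := by omega
    have hJ := two_pow_mul_sum_dyadicWeight hk.le
    have hJ' := two_pow_mul_sum_dyadicWeight (Nat.succ_le_of_lt hk)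
    have hne := compl_initialSet_nonempty (Nat.succ_le_of_lt hk)
    have h1 := integral_energy_le hF' he hN hJ ha hab
      (fun j hj τ hτ => form_energyPoly_nonneg hF he hN hJ
        (compl_initialSet_nonempty hk.le) hj hτ) hj
    have hkmem : (⟨k, hkn⟩ : Fin (n + 1)) ∈ initialSet n (k + 1) := by simp [mem_initialSet]
    have h2 := h M F hF hN a b ha hab hL ⟨k, hkn⟩ hkmem
    have hEi : IntegrableOn (form F (initialSet n (k + 1))
        (energyPoly (initialSet n (k + 1)) ⟨k, hkn⟩)) (Set.Icc a b) :=
      integrable_form_time hF' he hN hJ' ha hab (measurable_energyPoly _ _)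
        fun τ _ X => abs_energyPoly_le hkmem τ X
    have h3 := integral_le_of_energy (g := form F (initialSet n k) (centerPoly (initialSet n k)))
      ha hab hL hEi h2 fun s hs τ hτ => by
        have hτ0 := ha.trans_le hτ.1
        rw [← insert_initialSet hkn] at hJ' hne ⊢
        have hm : Measurable (centerPoly (initialSet n k) τ) := by unfold centerPoly; fun_prop
        have h4 := abs_integral_center_le hF he hN hJ' (two_pow_mul_dyadicWeight hk) hne
          (notMem_initialSet hkn) hτ0 (P := heatQuad τ) (integrable_heatQuad_mul_heat hτ0)
          (integrable_form hF' he hN hJ hτ0 hm (abs_centerPoly_le _ τ))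
          (c := 5 / 4 * (2 / τ)) (fun q hqm hq y => sq_integral_heatQuad_le hτ0 hqm hq y)
          (t := s / τ) (by positivity)
        refine h4.trans_eq ?_
        congr 2
        · ring
        · congr 1; field_simp; norm_num
    rw [card_initialSet (by omega)] at h1
    have h5 : 1 ≤ Real.log (b / a) ^ (1 - δ / 2) := Real.one_le_rpow hL (by linarith)
    have h6 : (1 + (k : ℝ) / 4) * ∫ τ in Set.Icc a b,
        |form F (initialSet n k) (centerPoly (initialSet n k)) τ| ≤
        (1 + k / 4) * ((1 + 5 / 2 * C) / 2 * Real.log (b / a) ^ (1 - δ / 2)) := by gcongr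
    calc _ ≤ _ := h1
      _ ≤ 4 * Real.log (b / a) ^ (1 - δ / 2) +
          (1 + k / 4) * ((1 + 5 / 2 * C) / 2 * Real.log (b / a) ^ (1 - δ / 2)) := by linarith
      _ = _ := by ring

/-! ### The form with a smooth truncation -/

/-- The time integral of the derivatives of the heat kernel is a smooth truncation of `1 / s`. -/
lemma integral_heatDeriv_time {a b : ℝ} (ha : 0 < a) (hab : a ≤ b) (s : ℝ) :
    ∫ τ in Set.Icc a b, (√τ)⁻¹ * heatDeriv τ s =
      -(2 / √(2 * Real.pi)) *
        ((Real.exp (-s ^ 2 / (2 * b)) - Real.exp (-s ^ 2 / (2 * a))) / s) := by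
  rcases eq_or_ne s 0 with rfl | hs
  · simp [heatDeriv]
  have hp := Real.pi_pos
  have h1 : ∀ τ ∈ Set.uIcc a b, HasDerivAt
      (fun t => -(2 / √(2 * Real.pi)) * (Real.exp (-s ^ 2 / (2 * t)) / s))
      ((√τ)⁻¹ * heatDeriv τ s) τ := fun τ hτ => by
    rw [Set.uIcc_of_le hab] at hτ
    have hτ0 : 0 < τ := ha.trans_le hτ.1
    have h2 : HasDerivAt (fun t : ℝ => -s ^ 2 / (2 * t)) (s ^ 2 / (2 * τ ^ 2)) τ := by
      have h := (((hasDerivAt_id τ).const_mul 2).fun_inv (by simp; positivity)).const_mul (-s ^ 2)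
      convert! h using 1
      · simp only [id]; field_simp
    convert! ((h2.exp.div_const s).const_mul (-(2 / √(2 * Real.pi)))) using 1
    rw [heatDeriv, heat, Real.sqrt_mul (by positivity)]
    have hsq : √τ ^ 2 = τ := Real.sq_sqrt hτ0.le
    have : √τ ≠ 0 := by positivity
    field_simp
    rw [hsq]
  have hint : IntervalIntegrable (fun τ => (√τ)⁻¹ * heatDeriv τ s) volume a b := by
    refine ContinuousOn.intervalIntegrable fun τ hτ => ?_
    rw [Set.uIcc_of_le hab] at hτ
    have hτ0 : 0 < τ := ha.trans_le hτ.1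
    have h3 : √τ ≠ 0 := by positivity
    have h4 : √(2 * Real.pi * τ) ≠ 0 := by positivity
    refine ContinuousAt.continuousWithinAt ?_
    unfold heatDeriv heat
    have h5 : ContinuousAt (fun t => √(2 * Real.pi * t)) τ := by fun_prop
    refine (Real.continuous_sqrt.continuousAt.inv₀ h3).mul
      (((continuousAt_const.div continuousAt_id hτ0.ne').neg).mul
        ((h5.inv₀ h4).mul ?_))
    exact Real.continuous_exp.continuousAt.comp
      (continuousAt_const.div (by fun_prop) (by positivity))
  rw [integral_Icc_eq_integral_Ioc, ← intervalIntegral.integral_of_le hab,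
    intervalIntegral.integral_eq_sub_of_hasDerivAt h1 hint]
  ring

/-- Under the Gaussian pair weight, each selection of entries is distributed according to Lebesgue
measure, as in `lintegral_comp_pick`. -/
lemma integral_comp_pick {m : ℕ} {v : Fin m → ℝ} (hv : ∀ j, 0 < v j) (T : Finset (Fin m))
    {G : (Fin m → ℝ) → ℝ} (hG : Measurable G) :
    ∫ X, pairWeight v X * G (pick T X) = ∫ x, G x := by
  have hm : Measurable fun X => ENNReal.ofReal (pairWeight v X) :=
    (measurable_pairWeight v).ennreal_ofReal
  have h1 : Measure.map (pick T) (volume.withDensity fun X => ENNReal.ofReal (pairWeight v X)) =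
      volume := by
    ext s hs
    have h2 := lintegral_comp_pick hv T (measurable_one.indicator hs)
    rw [lintegral_indicator_one hs] at h2
    rw [Measure.map_apply (measurable_pick T) hs, withDensity_apply _ (measurable_pick T hs), ← h2,
      ← lintegral_indicator (measurable_pick T hs)]
    refine lintegral_congr fun X => ?_
    by_cases h : pick T X ∈ s <;> simp [Set.indicator, h]
  rw [← h1, integral_map (measurable_pick T).aemeasurable hG.aestronglyMeasurable,
    integral_withDensity_eq_integral_toReal_smul hm (ae_of_all _ fun _ => ENNReal.ofReal_lt_top)]
  simp [ENNReal.toReal_ofReal (pairWeight_nonneg _ _)]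

/-- The bound with a power gain, for the smoothly truncated kernel and the exponents
`2, 4, …, 2ⁿ, 2ⁿ`. -/
lemma exists_smooth_bound {n : ℕ} (hn : 1 ≤ n) :
    ∃ C δ : ℝ, 0 ≤ C ∧ 0 < δ ∧ δ ≤ 1 ∧ ∀ (M : ℝ) (F : Fin (n + 1) → (Fin n → ℝ) → ℝ),
      (∀ i, IsTest M (F i)) → Normalized (dyadicWeight n) F → ∀ a b : ℝ, 0 < a → a ≤ b →
        1 ≤ Real.log (b / a) →
          |∫ x : Fin (n + 1) → ℝ, (∏ i, F i (i.removeNth x)) *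
            ((Real.exp (-(∑ i, x i) ^ 2 / (2 * b)) - Real.exp (-(∑ i, x i) ^ 2 / (2 * a))) /
              ∑ i, x i)| ≤ C * Real.log (b / a) ^ (1 - δ) := by
  have he := dyadicWeight_pos n
  have hp := Real.pi_pos
  obtain ⟨C, δ, hδ0, hδ1, h⟩ := exists_integral_energy_le hn
  refine ⟨√(2 * Real.pi) / 2 * |(1 + 5 / 2 * C) / 2|, δ / 2, by positivity, by positivity,
    by linarith, fun M F hF hN a b ha hab hL => ?_⟩
  have hF' := fun i => (hF i).measurable
  have hJ := two_pow_mul_sum_dyadicWeight (Nat.zero_le n)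
  have hJ' := two_pow_mul_sum_dyadicWeight hn
  have hne := compl_initialSet_nonempty hn
  have hmem : (⟨0, by omega⟩ : Fin (n + 1)) ∈ initialSet n 1 := by simp [mem_initialSet]
  have h2 := h M F hF hN a b ha hab hL ⟨0, by omega⟩ hmem
  have hEi : IntegrableOn (form F (initialSet n 1)
      (energyPoly (initialSet n 1) ⟨0, by omega⟩)) (Set.Icc a b) :=
    integrable_form_time hF' he hN hJ' ha hab (measurable_energyPoly _ _)
      fun τ _ X => abs_energyPoly_le hmem τ X
  set J := initialSet n 0 with hJdef
  have hJe : J = ∅ := by simp [hJdef, initialSet]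
  set P : ℝ → (Fin (n + 1) → ℝ × ℝ) → ℝ := fun τ X => (√τ)⁻¹ * -(center J X / τ) with hP
  have hPm : Measurable (Function.uncurry P) := by unfold Function.uncurry; fun_prop
  have habs : ∀ τ, 0 < τ → ∀ X, |center J X / τ| ≤ (1 + 1 / τ) * polyBound J τ X := by
    intro τ hτ X
    have a1 : heatQuad τ (center J X) = (center J X / τ) ^ 2 - 1 / τ := by unfold heatQuad; ring
    have a2 := le_abs_self (heatQuad τ (center J X))
    have a3 : |center J X / τ| ≤ 1 + (center J X / τ) ^ 2 := by
      rw [← sq_abs]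
      nlinarith [sq_nonneg (|center J X / τ| - 1), abs_nonneg (center J X / τ)]
    have a4 : 0 ≤ 1 / τ * |heatQuad τ (center J X)| := by positivity
    have a5 : polyBound J τ X = 1 + |heatQuad τ (center J X)| := by simp [polyBound, hJe]
    rw [a5]
    linarith
  have hPb : ∀ τ ∈ Set.Icc a b, ∀ X, |P τ X| ≤ ((√a)⁻¹ * (1 + 1 / a)) * polyBound J τ X := by
    intro τ hτ X
    have hτ0 := ha.trans_le hτ.1
    have h3 := habs τ hτ0 X
    have h4 := one_le_polyBound J τ X
    have h5 : (√τ)⁻¹ ≤ (√a)⁻¹ := by have := hτ.1; gcongr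
    have h6 : 1 / τ ≤ 1 / a := by have := hτ.1; gcongr
    rw [hP]
    simp only
    rw [abs_mul, abs_neg, abs_of_nonneg (by positivity : 0 ≤ (√τ)⁻¹), mul_assoc]
    have h7 : (1 + 1 / τ) * polyBound J τ X ≤ (1 + 1 / a) * polyBound J τ X := by gcongr
    exact mul_le_mul h5 (h3.trans h7) (abs_nonneg _) (by positivity)
  have h3 := integral_le_of_energy (g := form F J P) ha hab hL hEi h2 fun s hs τ hτ => by
    have hτ0 := ha.trans_le hτ.1
    rw [← insert_initialSet (by omega : 0 < n + 1), ← hJdef] at hJ' hne ⊢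
    have h4 := abs_integral_center_le hF he hN hJ' (two_pow_mul_dyadicWeight hn) hne
      (notMem_initialSet _) hτ0 (P := fun x => -(x / τ)) (integrable_heatDeriv hτ0)
      (integrable_form hF' he hN hJ hτ0 (P := fun X => -(center J X / τ)) (by fun_prop)
        (c := 1 + 1 / τ) fun X => by rw [abs_neg]; exact habs τ hτ0 X)
      (c := 5 / 4) (fun q hqm hq y => sq_integral_heatDeriv_le hτ0 hqm hq y)
      (t := s / √τ) (by positivity)
    have hE0 : 0 ≤ form F (insert ⟨0, by omega⟩ J)
        (energyPoly (insert ⟨0, by omega⟩ J) ⟨0, by omega⟩) τ :=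
      form_energyPoly_nonneg hF he hN hJ' hne (Finset.mem_insert_self _ _) hτ0
    have e1 : form F J P τ = (√τ)⁻¹ *
        ∫ X, cubeProd F J X * (kernel J τ X * -(center J X / τ)) := by
      rw [form, ← integral_const_mul]
      refine integral_congr_ae (ae_of_all _ fun X => ?_)
      simp only [hP]; ring
    rw [e1, abs_mul, abs_of_nonneg (by positivity : 0 ≤ (√τ)⁻¹)]
    have hsq : √τ * √τ = τ := Real.mul_self_sqrt hτ0.le
    refine (mul_le_mul_of_nonneg_left h4 (by positivity)).trans ?_
    rw [show 5 / 4 / (s / √τ) = √τ * (5 / 4 / s) by field_simp]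
    have e2 : (√τ)⁻¹ * (s / √τ) = s * (1 / τ) := by
      have h5 : (√τ)⁻¹ * (s / √τ) = s * (1 / (√τ * √τ)) := by field_simp
      rw [h5, hsq]
    have e3 : (√τ)⁻¹ * √τ = 1 := inv_mul_cancel₀ (by positivity)
    have e4 : 5 / 4 / s * form F (insert ⟨0, by omega⟩ J)
        (energyPoly (insert ⟨0, by omega⟩ J) ⟨0, by omega⟩) τ ≤
        5 / 2 / s * form F (insert ⟨0, by omega⟩ J)
        (energyPoly (insert ⟨0, by omega⟩ J) ⟨0, by omega⟩) τ := by gcongr; norm_num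
    calc _ = ((√τ)⁻¹ * (s / √τ) + (√τ)⁻¹ * √τ * (5 / 4 / s * form F (insert ⟨0, by omega⟩ J)
        (energyPoly (insert ⟨0, by omega⟩ J) ⟨0, by omega⟩) τ)) / 2 := by ring
      _ ≤ _ := by rw [e2, e3, one_mul]; gcongr
  have h4 : ∫ τ in Set.Icc a b, form F J P τ = -(2 / √(2 * Real.pi)) *
      ∫ x : Fin (n + 1) → ℝ, (∏ i, F i (i.removeNth x)) *
            ((Real.exp (-(∑ i, x i) ^ 2 / (2 * b)) - Real.exp (-(∑ i, x i) ^ 2 / (2 * a))) /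
              ∑ i, x i) := by
    unfold form
    rw [integral_integral_swap (integrable_form_prod hF' he hN hJ ha hab hPm hPb),
      ← integral_comp_pick (v := fun _ => 1) (fun _ => one_pos) ∅, ← integral_const_mul]
    · refine integral_congr_ae (ae_of_all _ fun X => ?_)
      have e1 : ∀ τ, kernel J τ X * P τ X = pairWeight (fun _ => 1) X *
          ((√τ)⁻¹ * heatDeriv τ (∑ i, pick ∅ X i)) := fun τ => by
        have : center ∅ X = ∑ i, pick ∅ X i := by simp [center, pick]
        simp only [kernel, hP, hJe, heatDeriv, this]
        have : doubledVar (∅ : Finset (Fin (n + 1))) τ = fun _ => 1 := by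
          funext j; simp [doubledVar]
        rw [this]; ring
      simp only [e1, integral_const_mul, integral_heatDeriv_time ha hab]
      simp only [cubeProd, hJe, Finset.compl_empty, Finset.powerset_empty, Finset.prod_singleton]
      ring
    · have : ∀ i : Fin (n + 1), Measurable fun x : Fin (n + 1) → ℝ => F i (i.removeNth x) :=
        fun i => (hF' i).comp (measurable_removeNth i)
      refine (Finset.measurable_prod _ fun i _ => this i).mul ?_
      fun_prop
  have h5 : |∫ τ in Set.Icc a b, form F J P τ| ≤
      (1 + 5 / 2 * C) / 2 * Real.log (b / a) ^ (1 - δ / 2) :=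
    (abs_integral_le_integral_abs).trans h3
  rw [h4, abs_mul, abs_neg, abs_of_nonneg (by positivity : 0 ≤ 2 / √(2 * Real.pi))] at h5
  have hs2 : 0 < √(2 * Real.pi) := by positivity
  have h6 := mul_le_mul_of_nonneg_left h5 (by positivity : 0 ≤ √(2 * Real.pi) / 2)
  rw [← mul_assoc, show √(2 * Real.pi) / 2 * (2 / √(2 * Real.pi)) = 1 by field_simp, one_mul] at h6
  refine h6.trans ?_
  have h7 : 0 ≤ Real.log (b / a) ^ (1 - δ / 2) := Real.rpow_nonneg (by linarith) _
  have h8 := le_abs_self ((1 + 5 / 2 * C) / 2)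
  calc _ ≤ √(2 * Real.pi) / 2 * (|(1 + 5 / 2 * C) / 2| * Real.log (b / a) ^ (1 - δ / 2)) := by
        gcongr
    _ = _ := by ring

/-! ### The trivial bound and the sharp truncation -/

lemma lintegral_removeNth_mul {n : ℕ} (i : Fin (n + 1)) {h : (Fin n → ℝ) → ENNReal}
    (hh : Measurable h) {κ : ℝ → ENNReal} (hκ : Measurable κ) :
    ∫⁻ x : Fin (n + 1) → ℝ, h (i.removeNth x) * κ (∑ j, x j) = (∫⁻ y, h y) * ∫⁻ s, κ s := by
  have hr := measurable_removeNth i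
  rw [lintegral_insertNth i (by fun_prop), ← lintegral_mul_const _ hh]
  refine lintegral_congr fun ω => ?_
  simp only [Fin.removeNth_insertNth, Fin.sum_univ_succAbove _ i, Fin.insertNth_apply_same,
    Fin.insertNth_apply_succAbove]
  rw [lintegral_const_mul _ (by fun_prop), lintegral_add_right_eq_self]

section

variable {𝕜 : Type*} [RCLike 𝕜] {n : ℕ} {F : Fin (n + 1) → (Fin n → ℝ) → 𝕜}
  {e : Fin (n + 1) → ℝ}

/-- Hölder's inequality on the hyperplanes on which the sum of the coordinates is constant. -/
lemma lintegral_norm_prod_le (hF : ∀ i, Measurable (F i)) (he : ∀ i, 0 < e i)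
    (he1 : ∑ i, e i = 1) (hN : Normalized e F) {κ : ℝ → ℝ} (hκ : Measurable κ) :
    ∫⁻ x : Fin (n + 1) → ℝ, ENNReal.ofReal ((∏ i, ‖F i (i.removeNth x)‖) * |κ (∑ j, x j)|) ≤
      ∫⁻ s, ENNReal.ofReal |κ s| := by
  refine lintegral_prod_mul_le Finset.univ (w := e)
    (g := fun i (x : Fin (n + 1) → ℝ) => ‖F i (i.removeNth x)‖) (K := fun x => |κ (∑ j, x j)|)
    (fun i _ => he i) he1
    (fun _ _ => norm_nonneg _) (fun i _ => ((hF i).comp (measurable_removeNth i)).norm)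
    (by fun_prop) (fun _ => abs_nonneg _) fun i _ => ?_
  have := (hF i).norm
  rw [lintegral_removeNth_mul i (h := fun y => ENNReal.ofReal (‖F i y‖ ^ (1 / e i)))
    (κ := fun s => ENNReal.ofReal |κ s|) (by fun_prop) (by fun_prop)]
  calc _ ≤ 1 * ∫⁻ s, ENNReal.ofReal |κ s| := by gcongr; exact hN i
    _ = _ := one_mul _

/-- The trivial bound for the form with kernel `κ`, by the `L¹` norm of `κ`. -/
lemma integrable_smul_prod (hF : ∀ i, Measurable (F i)) (he : ∀ i, 0 < e i)
    (he1 : ∑ i, e i = 1) (hN : Normalized e F) {κ : ℝ → ℝ} (hκ : Measurable κ)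
    {c : ℝ} (hc0 : 0 ≤ c) (hc : ∫⁻ s, ENNReal.ofReal |κ s| ≤ ENNReal.ofReal c) :
    Integrable (fun x : Fin (n + 1) → ℝ => κ (∑ j, x j) • ∏ i, F i (i.removeNth x)) ∧
      ‖∫ x : Fin (n + 1) → ℝ, κ (∑ j, x j) • ∏ i, F i (i.removeNth x)‖ ≤ c := by
  have hm : ∀ i : Fin (n + 1), Measurable fun x : Fin (n + 1) → ℝ => F i (i.removeNth x) :=
    fun i => (hF i).comp (measurable_removeNth i)
  have hm1 : Measurable fun x : Fin (n + 1) → ℝ => κ (∑ j, x j) • ∏ i, F i (i.removeNth x) :=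
    Measurable.smul (by fun_prop) (Finset.measurable_prod _ fun i _ => hm i)
  have e1 : ∀ x : Fin (n + 1) → ℝ, ‖κ (∑ j, x j) • ∏ i, F i (i.removeNth x)‖ =
      (∏ i, ‖F i (i.removeNth x)‖) * |κ (∑ j, x j)| := fun x => by
    rw [norm_smul, norm_prod, Real.norm_eq_abs, mul_comm]
  have h1 : ∫⁻ x : Fin (n + 1) → ℝ, ENNReal.ofReal ‖κ (∑ j, x j) • ∏ i, F i (i.removeNth x)‖ ≤
      ENNReal.ofReal c := by
    simp only [e1]
    exact (lintegral_norm_prod_le hF he he1 hN hκ).trans hc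
  have hi : Integrable fun x : Fin (n + 1) → ℝ => κ (∑ j, x j) • ∏ i, F i (i.removeNth x) := by
    refine ⟨hm1.aestronglyMeasurable, ?_⟩
    rw [hasFiniteIntegral_iff_norm]
    exact h1.trans_lt ENNReal.ofReal_lt_top
  refine ⟨hi, (norm_integral_le_integral_norm _).trans ?_⟩
  rw [← ofReal_integral_eq_lintegral_ofReal hi.norm (ae_of_all _ fun _ => norm_nonneg _)] at h1
  exact (ENNReal.ofReal_le_ofReal_iff hc0).1 h1

end

/-- The kernel `1 / s`, truncated sharply to `r ≤ |s| ≤ R`. -/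
def sharpKernel (r R s : ℝ) : ℝ := if r ≤ |s| ∧ |s| ≤ R then 1 / s else 0

/-- A smooth truncation of the kernel `1 / s` to the range `r ≤ |s| ≤ R`. -/
def smoothKernel (r R s : ℝ) : ℝ :=
  (Real.exp (-s ^ 2 / (2 * R ^ 2)) - Real.exp (-s ^ 2 / (2 * r ^ 2))) / s

@[fun_prop]
lemma measurable_sharpKernel (r R : ℝ) : Measurable (sharpKernel r R) := by
  unfold sharpKernel
  refine Measurable.ite ?_ (by fun_prop) measurable_const
  have h : Measurable fun s : ℝ => |s| := by fun_prop
  exact (measurableSet_le measurable_const h).inter (measurableSet_le h measurable_const)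

@[fun_prop]
lemma measurable_smoothKernel (r R : ℝ) : Measurable (smoothKernel r R) := by
  unfold smoothKernel; fun_prop

lemma lintegral_sharpKernel_le {r R : ℝ} (hr : 0 < r) (hrR : r < R) :
    ∫⁻ s, ENNReal.ofReal |sharpKernel r R s| ≤ ENNReal.ofReal (2 * Real.log (R / r)) := by
  set f : ℝ → ENNReal := (Set.Icc r R).indicator fun s => ENNReal.ofReal (1 / s) with hf
  have hfm : Measurable f := by
    refine Measurable.indicator (by fun_prop) measurableSet_Icc
  have hfi : ∫⁻ s, f s = ENNReal.ofReal (Real.log (R / r)) := by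
    obtain ⟨i1, i2⟩ := integral_one_div_Icc hr hrR.le
    rw [hf, lintegral_indicator measurableSet_Icc, ← i2,
      ofReal_integral_eq_lintegral_ofReal i1
        ((ae_restrict_mem measurableSet_Icc).mono fun s hs => ?_)]
    exact one_div_nonneg.2 (hr.le.trans hs.1)
  have h1 : ∀ s, ENNReal.ofReal |sharpKernel r R s| ≤ f s + f (-s) := by
    intro s
    unfold sharpKernel
    split_ifs with h
    · rcases le_total 0 s with hs | hs
      · rw [abs_of_nonneg hs] at h
        rw [abs_of_nonneg (by positivity), hf, Set.indicator_of_mem (show s ∈ Set.Icc r R from h)]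
        exact le_self_add
      · rw [abs_of_nonpos hs] at h
        rw [abs_div, abs_one, abs_of_nonpos hs, hf,
          Set.indicator_of_mem (show -s ∈ Set.Icc r R from h)]
        exact le_add_self
    · simp
  refine (lintegral_mono h1).trans ?_
  rw [lintegral_add_left hfm, lintegral_neg_eq_self f, hfi, ← two_mul,
    ENNReal.ofReal_mul (by norm_num)]
  simp

/-- The smooth truncation differs from the sharp one by Gaussian tails at the scales `r` and `R`. -/
lemma abs_sharpKernel_sub_smoothKernel_le {r R : ℝ} (hr : 0 < r) (hrR : r < R) (s : ℝ) :
    |sharpKernel r R s - smoothKernel r R s| ≤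
      √(2 * Real.pi) * (heat (r ^ 2) s + heat (R ^ 2) s) := by
  have hR : 0 < R := hr.trans hrR
  have hp := Real.pi_pos
  have key : ∀ ρ : ℝ, 0 < ρ → √(2 * Real.pi) * heat (ρ ^ 2) s =
      Real.exp (-s ^ 2 / (2 * ρ ^ 2)) / ρ := by
    intro ρ hρ
    rw [heat, Real.sqrt_mul (by positivity : 0 ≤ 2 * Real.pi) (ρ ^ 2), Real.sqrt_sq hρ.le]
    field_simp
  rw [mul_add, key r hr, key R hR]
  set A := Real.exp (-s ^ 2 / (2 * r ^ 2)) with hA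
  set B := Real.exp (-s ^ 2 / (2 * R ^ 2)) with hB
  have hA0 : 0 < A := Real.exp_pos _
  have hB0 : 0 < B := Real.exp_pos _
  have hAB : A ≤ B := by
    refine Real.exp_le_exp.2 ?_
    rw [neg_div, neg_div, neg_le_neg_iff]
    gcongr
  have hB1 : B ≤ 1 := Real.exp_le_one_iff.2 (by rw [neg_div]; simp; positivity)
  rcases eq_or_ne s 0 with rfl | hs0
  · simp [sharpKernel, smoothKernel]; positivity
  have hs : 0 < |s| := abs_pos.2 hs0
  -- For `|s| ≤ ρ` the error `(1 - exp (-s² / 2ρ²)) / |s|` is at most `1 / (2ρ)`, and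
  -- `exp (-s² / 2ρ²)` is at least `1 / 2`.
  have small : ∀ ρ : ℝ, 0 < ρ → |s| ≤ ρ → (1 - Real.exp (-s ^ 2 / (2 * ρ ^ 2))) / |s| ≤
      Real.exp (-s ^ 2 / (2 * ρ ^ 2)) / ρ := by
    intro ρ hρ hsρ
    have h1 := Real.add_one_le_exp (-s ^ 2 / (2 * ρ ^ 2))
    have h2 : s ^ 2 / (2 * ρ ^ 2) = |s| * (|s| / (2 * ρ ^ 2)) := by rw [← sq_abs]; ring
    have h3 : |s| / (2 * ρ ^ 2) ≤ 1 / (2 * ρ) := by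
      rw [div_le_div_iff₀ (by positivity) (by positivity)]; nlinarith
    have h4 : s ^ 2 / (2 * ρ ^ 2) ≤ 1 / 2 := by
      rw [div_le_iff₀ (by positivity), ← sq_abs]
      nlinarith
    rw [neg_div] at h1 ⊢
    rw [div_le_div_iff₀ hs hρ]
    have h5 : 1 - Real.exp (-(s ^ 2 / (2 * ρ ^ 2))) ≤ s ^ 2 / (2 * ρ ^ 2) := by linarith
    have h6 : (1 : ℝ) / 2 ≤ Real.exp (-(s ^ 2 / (2 * ρ ^ 2))) := by linarith
    have h7 : s ^ 2 / (2 * ρ ^ 2) ≤ |s| * (1 / (2 * ρ)) := by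
      rw [h2]; gcongr
    calc (1 - Real.exp (-(s ^ 2 / (2 * ρ ^ 2)))) * ρ ≤ |s| * (1 / (2 * ρ)) * ρ := by
          gcongr; exact h5.trans h7
      _ = 1 / 2 * |s| := by field_simp
      _ ≤ _ := by gcongr
  have hAr : 0 ≤ A / r := by positivity
  have hBR : 0 ≤ B / R := by positivity
  unfold sharpKernel smoothKernel
  rw [← hA, ← hB]
  split_ifs with h
  · have e1 : 1 / s - (B - A) / s = ((1 - B) + A) / s := by ring
    rw [e1, abs_div, abs_of_nonneg (by linarith), add_div]
    have h1 := small R hR h.2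
    have h2 : A / |s| ≤ A / r := by gcongr; exact h.1
    linarith
  · rw [zero_sub, abs_neg, abs_div, abs_of_nonneg (by linarith)]
    by_cases h' : r ≤ |s|
    · have h2 : (B - A) / |s| ≤ B / R := by
        have h3 : R ≤ |s| := le_of_lt (not_le.1 fun h3 => h ⟨h', h3⟩)
        gcongr
        linarith
      linarith
    · have h1 := small r hr (not_le.1 h').le
      have h2 : (B - A) / |s| ≤ (1 - A) / |s| := by gcongr
      linarith

lemma lintegral_sharpKernel_sub_smoothKernel_le {r R : ℝ} (hr : 0 < r) (hrR : r < R) :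
    ∫⁻ s, ENNReal.ofReal |sharpKernel r R s - smoothKernel r R s| ≤
      ENNReal.ofReal (√(2 * Real.pi) * 2) := by
  have hR : 0 < R := hr.trans hrR
  have i1 := integrable_heat (pow_pos hr 2)
  have i2 := integrable_heat (pow_pos hR 2)
  have h1 : ∫ s, √(2 * Real.pi) * (heat (r ^ 2) s + heat (R ^ 2) s) = √(2 * Real.pi) * 2 := by
    rw [integral_const_mul, integral_add i1 i2, integral_heat (pow_pos hr 2),
      integral_heat (pow_pos hR 2)]
    norm_num
  have i3 : Integrable fun s => √(2 * Real.pi) * (heat (r ^ 2) s + heat (R ^ 2) s) :=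
    (i1.add i2).const_mul _
  rw [← h1, ofReal_integral_eq_lintegral_ofReal i3
    (ae_of_all _ fun s => mul_nonneg (Real.sqrt_nonneg _)
      (add_nonneg (heat_nonneg _ _) (heat_nonneg _ _)))]
  exact lintegral_mono fun s =>
    ENNReal.ofReal_le_ofReal (abs_sharpKernel_sub_smoothKernel_le hr hrR s)

lemma sum_dyadicWeight (n : ℕ) : ∑ i, dyadicWeight n i = 1 := by
  simpa [initialSet] using two_pow_mul_sum_dyadicWeight (Nat.zero_le n)

/-- The bound with a power gain for real functions and the exponents `2, 4, …, 2ⁿ, 2ⁿ`. -/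
lemma exists_sharp_bound_real {n : ℕ} (hn : 1 ≤ n) :
    ∃ C δ : ℝ, 0 ≤ C ∧ 0 < δ ∧ δ ≤ 1 ∧ ∀ (M : ℝ) (F : Fin (n + 1) → (Fin n → ℝ) → ℝ),
      (∀ i, IsTest M (F i)) → Normalized (dyadicWeight n) F → ∀ r R : ℝ, 0 < r → r < R →
        1 ≤ Real.log (R / r) →
          |∫ x : Fin (n + 1) → ℝ, sharpKernel r R (∑ i, x i) • ∏ i, F i (i.removeNth x)| ≤
            C * Real.log (R / r) ^ (1 - δ) := by
  obtain ⟨C, δ, hC, hδ0, hδ1, h⟩ := exists_smooth_bound hn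
  refine ⟨C * 2 + √(2 * Real.pi) * 2, δ, by positivity, hδ0, hδ1,
    fun M F hF hN r R hr hrR hL => ?_⟩
  have hR := hr.trans hrR
  have hF' := fun i => (hF i).measurable
  have hlog : Real.log (R ^ 2 / r ^ 2) = 2 * Real.log (R / r) := by
    rw [← div_pow, Real.log_pow]; norm_num
  have h1 := h M F hF hN (r ^ 2) (R ^ 2) (by positivity) (by gcongr) (by rw [hlog]; linarith)
  obtain ⟨i1, -⟩ := integrable_smul_prod hF' (dyadicWeight_pos n) (sum_dyadicWeight n) hN
    (measurable_sharpKernel r R) (by positivity) (lintegral_sharpKernel_le hr hrR)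
  obtain ⟨i2, h2⟩ := integrable_smul_prod hF' (dyadicWeight_pos n) (sum_dyadicWeight n) hN
    (κ := fun s => sharpKernel r R s - smoothKernel r R s) (by fun_prop) (by positivity)
    (lintegral_sharpKernel_sub_smoothKernel_le hr hrR)
  have e1 : ∫ x : Fin (n + 1) → ℝ, (∏ i, F i (i.removeNth x)) *
      ((Real.exp (-(∑ i, x i) ^ 2 / (2 * R ^ 2)) - Real.exp (-(∑ i, x i) ^ 2 / (2 * r ^ 2))) /
        ∑ i, x i) = (∫ x : Fin (n + 1) → ℝ, sharpKernel r R (∑ i, x i) • ∏ i, F i (i.removeNth x)) -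
      ∫ x : Fin (n + 1) → ℝ, (sharpKernel r R (∑ i, x i) - smoothKernel r R (∑ i, x i)) •
        ∏ i, F i (i.removeNth x) := by
    rw [← integral_sub i1 i2]
    refine integral_congr_ae (ae_of_all _ fun x => ?_)
    simp only [smul_eq_mul, smoothKernel]; ring
  rw [e1, hlog] at h1
  rw [Real.norm_eq_abs] at h2
  have h3 : (2 * Real.log (R / r)) ^ (1 - δ) ≤ 2 * Real.log (R / r) ^ (1 - δ) := by
    rw [Real.mul_rpow (by norm_num) (by linarith)]
    gcongr
    calc (2 : ℝ) ^ (1 - δ) ≤ 2 ^ (1 : ℝ) := by gcongr <;> linarith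
      _ = 2 := Real.rpow_one 2
  have h4 : 1 ≤ Real.log (R / r) ^ (1 - δ) := Real.one_le_rpow hL (by linarith)
  set I := ∫ x : Fin (n + 1) → ℝ, sharpKernel r R (∑ i, x i) • ∏ i, F i (i.removeNth x)
  set I' := ∫ x : Fin (n + 1) → ℝ, (sharpKernel r R (∑ i, x i) - smoothKernel r R (∑ i, x i)) •
        ∏ i, F i (i.removeNth x)
  have h5 : |I| ≤ |I - I'| + |I'| := by
    calc |I| = |(I - I') + I'| := by ring_nf
      _ ≤ _ := abs_add_le _ _
  have h6 : C * (2 * Real.log (R / r)) ^ (1 - δ) ≤ C * (2 * Real.log (R / r) ^ (1 - δ)) := by gcongr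
  have h7 : √(2 * Real.pi) * 2 * 1 ≤ √(2 * Real.pi) * 2 * Real.log (R / r) ^ (1 - δ) := by gcongr
  linarith

/-- The bound with a power gain for the exponents `2, 4, …, 2ⁿ, 2ⁿ`. -/
lemma exists_sharp_bound {n : ℕ} (hn : 1 ≤ n) :
    ∃ C δ : ℝ, 0 ≤ C ∧ 0 < δ ∧ δ ≤ 1 ∧ ∀ (M : ℝ) (F : Fin (n + 1) → (Fin n → ℝ) → ℂ),
      (∀ i, IsTest M (F i)) → Normalized (dyadicWeight n) F → ∀ r R : ℝ, 0 < r → r < R →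
        1 ≤ Real.log (R / r) →
          ‖∫ x : Fin (n + 1) → ℝ, sharpKernel r R (∑ i, x i) • ∏ i, F i (i.removeNth x)‖ ≤
            C * Real.log (R / r) ^ (1 - δ) := by
  obtain ⟨C, δ, hC, hδ0, hδ1, h⟩ := exists_sharp_bound_real hn
  refine ⟨2 ^ (n + 1) * C, δ, by positivity, hδ0, hδ1, fun M F hF hN r R hr hrR hL => ?_⟩
  -- Expand each `F i` into its real and imaginary part; `G t` selects the real part for `i ∈ t`.
  set G : Finset (Fin (n + 1)) → Fin (n + 1) → (Fin n → ℝ) → ℝ :=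
    fun t i y => if i ∈ t then (F i y).re else (F i y).im with hG
  have hGle : ∀ t i y, |G t i y| ≤ ‖F i y‖ := fun t i y => by
    simp only [hG]
    split_ifs
    · exact Complex.abs_re_le_norm _
    · exact Complex.abs_im_le_norm _
  have hGt : ∀ t i, IsTest M (G t i) := fun t i => by
    refine ⟨?_, fun y => (hGle t i y).trans ((hF i).norm_le y), fun y l hl => ?_⟩
    · have := (hF i).measurable
      simp only [hG]
      split_ifs <;> fun_prop
    · have := (hF i).eq_zero y l hl
      simp [hG, this]
  have hGN : ∀ t, Normalized (dyadicWeight n) (G t) := fun t i => by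
    refine (lintegral_mono fun y => ENNReal.ofReal_le_ofReal ?_).trans (hN i)
    exact Real.rpow_le_rpow (abs_nonneg _) (hGle t i y)
      (one_div_nonneg.2 (dyadicWeight_pos n i).le)
  have e1 : ∀ x : Fin (n + 1) → ℝ, sharpKernel r R (∑ i, x i) • ∏ i, F i (i.removeNth x) =
      ∑ t ∈ (Finset.univ : Finset (Fin (n + 1))).powerset,
        Complex.I ^ (Finset.univ \ t).card *
          ((sharpKernel r R (∑ i, x i) • ∏ i, G t i (i.removeNth x) : ℝ) : ℂ) := fun x => by
    have e2 : ∏ i, F i (i.removeNth x) =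
        ∏ i, (((F i (i.removeNth x)).re : ℂ) + (F i (i.removeNth x)).im * Complex.I) :=
      Finset.prod_congr rfl fun i _ => (Complex.re_add_im _).symm
    rw [e2, Finset.prod_add, Finset.smul_sum]
    refine Finset.sum_congr rfl fun t ht => ?_
    rw [Finset.prod_mul_distrib, Finset.prod_const]
    have e3 : ∏ i, G t i (i.removeNth x) =
        (∏ i ∈ t, (F i (i.removeNth x)).re) * ∏ i ∈ Finset.univ \ t, (F i (i.removeNth x)).im := by
      rw [← Finset.prod_sdiff (Finset.subset_univ t), mul_comm]
      congr 1
      · exact Finset.prod_congr rfl fun i hi => by simp [hG, hi]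
      · exact Finset.prod_congr rfl fun i hi => by
          simp [hG, (Finset.mem_sdiff.1 hi).2]
    rw [e3, Complex.real_smul, smul_eq_mul]
    push_cast
    ring
  have hi : ∀ t, Integrable fun x : Fin (n + 1) → ℝ =>
      sharpKernel r R (∑ i, x i) • ∏ i, G t i (i.removeNth x) := fun t =>
    (integrable_smul_prod (fun i => (hGt t i).measurable) (dyadicWeight_pos n) (sum_dyadicWeight n)
      (hGN t) (measurable_sharpKernel r R) (by positivity) (lintegral_sharpKernel_le hr hrR)).1
  simp only [e1]
  rw [integral_finsetSum _ fun t _ => (hi t).ofReal.const_mul _]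
  refine (norm_sum_le _ _).trans ?_
  have h1 : ∀ t ∈ (Finset.univ : Finset (Fin (n + 1))).powerset,
      ‖∫ x : Fin (n + 1) → ℝ, Complex.I ^ (Finset.univ \ t).card *
        ((sharpKernel r R (∑ i, x i) • ∏ i, G t i (i.removeNth x) : ℝ) : ℂ)‖ ≤
      C * Real.log (R / r) ^ (1 - δ) := fun t _ => by
    rw [integral_const_mul, norm_mul, norm_pow, Complex.norm_I, one_pow, one_mul,
      integral_complex_ofReal, Complex.norm_real]
    exact h M (G t) (hGt t) (hGN t) r R hr hrR hL
  refine (Finset.sum_le_card_nsmul _ _ _ h1).trans_eq ?_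
  simp [mul_assoc]

/-! ### Complex interpolation -/

/-- An integral depending exponentially on a complex parameter is entire. -/
lemma differentiable_integral_exp {α : Type*} [MeasurableSpace α] {μ : Measure α} {φ : α → ℂ}
    (hφ : Integrable φ μ) {A B : α → ℝ} (hA : Measurable A) (hB : Measurable B) {K : ℝ}
    (hAK : ∀ x, |A x| ≤ K) (hBK : ∀ x, |B x| ≤ K) :
    Differentiable ℂ fun z : ℂ => ∫ x, φ x * Complex.exp (A x + z * B x) ∂μ := by
  intro z₀
  have hm : ∀ z : ℂ, AEStronglyMeasurable (fun x => φ x * Complex.exp (A x + z * B x)) μ :=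
    fun z => hφ.aestronglyMeasurable.mul (Measurable.aestronglyMeasurable (by fun_prop))
  have hexp : ∀ z : ℂ, ∀ x, ‖Complex.exp (A x + z * B x)‖ ≤ Real.exp (K + |z.re| * K) := by
    intro z x
    rw [Complex.norm_exp]
    refine Real.exp_le_exp.2 ?_
    have h1 : (A x + z * B x : ℂ).re = A x + z.re * B x := by simp
    rw [h1]
    have h2 := (le_abs_self _).trans (hAK x)
    have h3 : z.re * B x ≤ |z.re| * K :=
      (le_abs_self _).trans ((abs_mul _ _).trans_le (by gcongr; exact hBK x))
    linarith
  have h := hasDerivAt_integral_of_dominated_loc_of_deriv_le (μ := μ) (𝕜 := ℂ)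
    (F := fun z x => φ x * Complex.exp (A x + z * B x))
    (F' := fun z x => φ x * (Complex.exp (A x + z * B x) * B x)) (x₀ := z₀)
    (s := Metric.ball z₀ 1)
    (bound := fun x => ‖φ x‖ * (Real.exp (K + (|z₀.re| + 1) * K) * K))
    (Metric.ball_mem_nhds z₀ one_pos) (Filter.Eventually.of_forall hm) ?_ ?_ ?_ ?_ ?_
  · exact h.2.differentiableAt
  · exact hφ.mul_bdd (c := Real.exp (K + |z₀.re| * K))
      (Measurable.aestronglyMeasurable (by fun_prop)) (ae_of_all _ (hexp z₀))
  · exact hφ.aestronglyMeasurable.mul (Measurable.aestronglyMeasurable (by fun_prop))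
  · refine ae_of_all _ fun x z hz => ?_
    have hK : 0 ≤ K := (abs_nonneg _).trans (hAK x)
    have h1 : |z.re| ≤ |z₀.re| + 1 := by
      have h2 : |z.re - z₀.re| ≤ 1 := by
        rw [← Complex.sub_re]
        exact (Complex.abs_re_le_norm _).trans (mem_ball_iff_norm.1 hz).le
      have h3 := abs_sub_abs_le_abs_sub z.re z₀.re
      linarith
    rw [norm_mul, norm_mul, Complex.norm_real, Real.norm_eq_abs]
    have h4 : Real.exp (K + |z.re| * K) ≤ Real.exp (K + (|z₀.re| + 1) * K) := by gcongr
    gcongr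
    · exact (hexp z x).trans h4
    · exact hBK x
  · exact hφ.norm.mul_const _
  · refine ae_of_all _ fun x z _ => ?_
    have h1 : HasDerivAt (fun z : ℂ => (A x : ℂ) + z * B x) (B x) z := by
      simpa using ((hasDerivAt_id z).mul_const (B x : ℂ)).const_add (A x : ℂ)
    exact h1.cexp.const_mul (φ x)

section

variable {n : ℕ} {F : Fin (n + 1) → (Fin n → ℝ) → ℂ} {w v e : Fin (n + 1) → ℝ}

/-- The analytic family `F |F| ^ (a - 1)` with `a = ((1 - z) v + z e) / w`. As `Real.log 0 = 0`, it
vanishes wherever `F` does. -/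
def analyticFamily (F : Fin (n + 1) → (Fin n → ℝ) → ℂ) (w v e : Fin (n + 1) → ℝ) (z : ℂ)
    (i : Fin (n + 1)) (y : Fin n → ℝ) : ℂ :=
  F i y * Complex.exp ((((1 - z) * v i + z * e i) / w i - 1) * Real.log ‖F i y‖)

lemma norm_analyticFamily (z : ℂ) (i : Fin (n + 1)) (y : Fin n → ℝ) (hF : F i y ≠ 0) :
    ‖analyticFamily F w v e z i y‖ = ‖F i y‖ ^ (((1 - z.re) * v i + z.re * e i) / w i) := by
  have h1 : ((((1 - z) * v i + z * e i) / w i - 1) * Real.log ‖F i y‖ : ℂ).re =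
      Real.log ‖F i y‖ * (((1 - z.re) * v i + z.re * e i) / w i) - Real.log ‖F i y‖ := by
    have : ((((1 - z) * v i + z * e i) / w i - 1) * Real.log ‖F i y‖ : ℂ) =
        (((1 - z) * (v i : ℂ) + z * (e i : ℂ)) / (w i : ℂ) - 1) *
          ((Real.log ‖F i y‖ : ℝ) : ℂ) := rfl
    rw [this, Complex.re_mul_ofReal, Complex.sub_re, Complex.div_ofReal_re, Complex.add_re,
      Complex.re_mul_ofReal, Complex.re_mul_ofReal, Complex.sub_re, Complex.one_re]
    ring
  have h2 : 0 < ‖F i y‖ := norm_pos_iff.2 hF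
  rw [analyticFamily, norm_mul, Complex.norm_exp, h1, Real.exp_sub, Real.exp_log h2,
    Real.rpow_def_of_pos h2]
  field_simp

lemma isTest_analyticFamily {M c : ℝ} (hc : 0 < c) (hF : ∀ i, IsTest M (F i))
    (hFc : ∀ i y, F i y ≠ 0 → c ≤ ‖F i y‖) (z : ℂ) :
    ∃ M', ∀ i, IsTest M' (analyticFamily F w v e z i) := by
  set a : Fin (n + 1) → ℝ := fun i => ((1 - z.re) * v i + z.re * e i) / w i with ha
  set b : ℝ := ∑ i, (M ^ a i + c ^ a i) with hb
  have hterm : ∀ i y, F i y ≠ 0 → ‖F i y‖ ^ a i ≤ b := by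
    intro i y hy
    have h1 := (hF i).norm_le y
    have h2 := hFc i y hy
    have hM : 0 < M := hc.trans_le (h2.trans h1)
    have h3 : ‖F i y‖ ^ a i ≤ M ^ a i + c ^ a i := by
      rcases le_total 0 (a i) with h | h
      · have := Real.rpow_le_rpow (norm_nonneg _) h1 h
        have := Real.rpow_pos_of_pos hc (a i)
        linarith
      · have := Real.rpow_le_rpow_of_nonpos hc h2 h
        have := Real.rpow_pos_of_pos hM (a i)
        linarith
    exact h3.trans (Finset.single_le_sum (f := fun i => M ^ a i + c ^ a i)
      (fun j _ => by positivity) (Finset.mem_univ i))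
  refine ⟨max M |b|, fun i => ⟨?_, fun y => ?_, fun y l hl => ?_⟩⟩
  · have := (hF i).measurable
    unfold analyticFamily
    fun_prop
  · by_cases hy : F i y = 0
    · simp only [analyticFamily, hy, zero_mul, norm_zero]
      exact (abs_nonneg b).trans (le_max_right _ _)
    · rw [norm_analyticFamily z i y hy]
      exact (hterm i y hy).trans ((le_abs_self b).trans (le_max_right _ _))
  · simp [analyticFamily, (hF i).eq_zero y l ((le_max_left _ _).trans_lt hl)]

lemma normalized_analyticFamily {u : Fin (n + 1) → ℝ} (hu : ∀ i, 0 < u i) (hw : ∀ i, 0 < w i)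
    (hN : Normalized w F) {z : ℂ} (hz : ∀ i, (1 - z.re) * v i + z.re * e i = u i) :
    Normalized u (analyticFamily F w v e z) := fun i => by
  refine (lintegral_mono fun y => ENNReal.ofReal_le_ofReal ?_).trans (hN i)
  by_cases hy : F i y = 0
  · simp only [analyticFamily, hy, zero_mul, norm_zero]
    rw [Real.zero_rpow (one_div_ne_zero (hu i).ne'), Real.zero_rpow (one_div_ne_zero (hw i).ne')]
  · have h1 := (hu i).ne'
    rw [norm_analyticFamily z i y hy, hz, ← Real.rpow_mul (norm_nonneg _)]
    refine le_of_eq ?_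
    congr 1
    field_simp

/-- Complex interpolation for the multilinear form with kernel `κ`, for functions that are bounded
below on their supports. -/
lemma norm_integral_le_of_interpolation {κ : ℝ → ℝ} (hκ : Measurable κ) {D : ℝ} (hD : 0 ≤ D)
    (hκD : ∫⁻ s, ENNReal.ofReal |κ s| ≤ ENNReal.ofReal D) {a b θ : ℝ} (hθ : θ ∈ Set.Ioo 0 1)
    (hw : ∀ i, 0 < w i) (hw1 : ∑ i, w i = 1) (hv : ∀ i, 0 < v i) (he : ∀ i, 0 < e i)
    (hwve : ∀ i, w i = (1 - θ) * v i + θ * e i)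
    (ha : ∀ (M : ℝ) (G : Fin (n + 1) → (Fin n → ℝ) → ℂ), (∀ i, IsTest M (G i)) →
      Normalized v G → ‖∫ x : Fin (n + 1) → ℝ, κ (∑ i, x i) • ∏ i, G i (i.removeNth x)‖ ≤ a)
    (hb : ∀ (M : ℝ) (G : Fin (n + 1) → (Fin n → ℝ) → ℂ), (∀ i, IsTest M (G i)) →
      Normalized e G → ‖∫ x : Fin (n + 1) → ℝ, κ (∑ i, x i) • ∏ i, G i (i.removeNth x)‖ ≤ b)
    {M c : ℝ} (hc : 0 < c) (hF : ∀ i, IsTest M (F i)) (hFc : ∀ i y, F i y ≠ 0 → c ≤ ‖F i y‖)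
    (hN : Normalized w F) :
    ‖∫ x : Fin (n + 1) → ℝ, κ (∑ i, x i) • ∏ i, F i (i.removeNth x)‖ ≤ a ^ (1 - θ) * b ^ θ := by
  have hF' := fun i => (hF i).measurable
  obtain ⟨hφ, -⟩ := integrable_smul_prod hF' hw hw1 hN hκ hD hκD
  set φ : (Fin (n + 1) → ℝ) → ℂ := fun x => κ (∑ i, x i) • ∏ i, F i (i.removeNth x) with hφdef
  set lg : Fin (n + 1) → (Fin (n + 1) → ℝ) → ℝ := fun i x => Real.log ‖F i (i.removeNth x)‖ with hlg
  have hlgm : ∀ i, Measurable (lg i) := fun i =>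
    Real.measurable_log.comp ((hF' i).comp (measurable_removeNth i)).norm
  set K₀ := |Real.log M| + |Real.log c| with hK₀
  have hlgK : ∀ i x, |lg i x| ≤ K₀ := by
    intro i x
    simp only [hlg]
    by_cases hy : F i (i.removeNth x) = 0
    · simp only [hy, norm_zero, Real.log_zero, abs_zero]; positivity
    · have h1 := hFc i _ hy
      have h2 := (hF i).norm_le (i.removeNth x)
      have h3 := Real.log_le_log hc h1
      have h4 := Real.log_le_log (hc.trans_le h1) h2
      have h5 := neg_abs_le (Real.log c)
      have h6 := le_abs_self (Real.log M)
      have h7 := abs_nonneg (Real.log c)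
      have h8 := abs_nonneg (Real.log M)
      rw [abs_le]; constructor <;> linarith
  set A : (Fin (n + 1) → ℝ) → ℝ := fun x => ∑ i, (v i / w i - 1) * lg i x with hA
  set B : (Fin (n + 1) → ℝ) → ℝ := fun x => ∑ i, ((e i - v i) / w i) * lg i x with hB
  set K := (∑ i, |v i / w i - 1| * K₀) + ∑ i, |(e i - v i) / w i| * K₀ with hK
  have hK₀0 : 0 ≤ K₀ := by positivity
  have hbound : ∀ (u : Fin (n + 1) → ℝ) x, |∑ i, u i * lg i x| ≤ ∑ i, |u i| * K₀ := fun u x => by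
    refine (Finset.abs_sum_le_sum_abs _ _).trans (Finset.sum_le_sum fun i _ => ?_)
    rw [abs_mul]
    gcongr
    exact hlgK i x
  have hAK : ∀ x, |A x| ≤ K := fun x => (hbound (fun i => v i / w i - 1) x).trans
    (le_add_of_nonneg_right (Finset.sum_nonneg fun i _ => by positivity))
  have hBK : ∀ x, |B x| ≤ K := fun x => (hbound (fun i => (e i - v i) / w i) x).trans
    (le_add_of_nonneg_left (Finset.sum_nonneg fun i _ => by positivity))
  have hAm : Measurable A := by fun_prop
  have hBm : Measurable B := by fun_prop
  set f : ℂ → ℂ := fun z => ∫ x, φ x * Complex.exp (A x + z * B x) with hf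
  have hfe : ∀ z, f z = ∫ x : Fin (n + 1) → ℝ,
      κ (∑ i, x i) • ∏ i, analyticFamily F w v e z i (i.removeNth x) := fun z => by
    refine integral_congr_ae (ae_of_all _ fun x => ?_)
    simp only [hφdef, analyticFamily, Finset.prod_mul_distrib, ← Complex.exp_sum]
    rw [smul_mul_assoc]
    congr 3
    simp only [hA, hB, hlg]
    push_cast
    rw [Finset.mul_sum, ← Finset.sum_add_distrib]
    refine Finset.sum_congr rfl fun i _ => ?_
    have : (w i : ℂ) ≠ 0 := by exact_mod_cast (hw i).ne'
    field_simp
    ring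
  have hfθ : f θ = ∫ x : Fin (n + 1) → ℝ, κ (∑ i, x i) • ∏ i, F i (i.removeNth x) := by
    rw [hfe]
    congr 1
    funext x
    congr 1
    refine Finset.prod_congr rfl fun i _ => ?_
    have h1 : (((1 - (θ : ℂ)) * v i + θ * e i) / w i) = 1 := by
      have h2 : (1 - (θ : ℂ)) * v i + θ * e i = w i := by rw [hwve i]; push_cast; ring
      rw [h2, div_self (by exact_mod_cast (hw i).ne')]
    rw [analyticFamily, h1]
    simp
  have hdiff : Differentiable ℂ f := differentiable_integral_exp hφ hAm hBm hAK hBK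
  rw [← hfθ]
  have h3 := Complex.HadamardThreeLines.norm_le_interp_of_mem_verticalClosedStrip₀₁' f
    (z := θ) (a := a) (b := b) ?_ hdiff.diffContOnCl ?_ ?_ ?_
  · simpa using h3
  · simp [Complex.HadamardThreeLines.verticalClosedStrip, hθ.1.le, hθ.2.le]
  · refine ⟨∫ x, ‖φ x‖ * Real.exp (K + K), ?_⟩
    rintro _ ⟨z, hz, rfl⟩
    simp only [Complex.HadamardThreeLines.verticalClosedStrip, Set.mem_preimage, Set.mem_Icc] at hz
    refine norm_integral_le_of_norm_le (hφ.norm.mul_const _) (ae_of_all _ fun x => ?_)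
    rw [norm_mul, Complex.norm_exp]
    have h4 : (A x + z * B x : ℂ).re = A x + z.re * B x := by simp
    rw [h4]
    have h5 := (le_abs_self _).trans (hAK x)
    have h6 : z.re * B x ≤ 1 * K := (le_abs_self _).trans ((abs_mul _ _).trans_le (by
      rw [abs_of_nonneg hz.1]
      exact mul_le_mul hz.2 (hBK x) (abs_nonneg _) zero_le_one))
    gcongr
    linarith
  · intro z hz
    rw [Set.mem_preimage, Set.mem_singleton_iff] at hz
    obtain ⟨M', hM'⟩ := isTest_analyticFamily (w := w) (v := v) (e := e) hc hF hFc z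
    rw [hfe]
    exact ha M' _ hM' (normalized_analyticFamily hv hw hN fun i => by rw [hz]; ring)
  · intro z hz
    rw [Set.mem_preimage, Set.mem_singleton_iff] at hz
    obtain ⟨M', hM'⟩ := isTest_analyticFamily (w := w) (v := v) (e := e) hc hF hFc z
    rw [hfe]
    exact hb M' _ hM' (normalized_analyticFamily he hw hN fun i => by rw [hz]; ring)

end

/-- A point of the open simplex is strictly between a given point of the simplex and another point
of the open simplex. -/
lemma exists_interpolation_weights {n : ℕ} {w e : Fin (n + 1) → ℝ}
    (hw : ∀ i, 0 < w i) (hw1 : ∑ i, w i = 1) (he1 : ∀ i, e i ≤ 1) (hes : ∑ i, e i = 1) :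
    ∃ (θ : ℝ) (v : Fin (n + 1) → ℝ), θ ∈ Set.Ioo 0 1 ∧ (∀ i, 0 < v i) ∧ ∑ i, v i = 1 ∧
      ∀ i, w i = (1 - θ) * v i + θ * e i := by
  -- With `θ` half of the least weight, `w - θ e` stays positive, because `e ≤ 1`.
  obtain ⟨i₀, hi₀⟩ := Finite.exists_min w
  have hle : ∀ i, w i ≤ 1 := fun i => by
    rw [← hw1]; exact Finset.single_le_sum (fun j _ => (hw j).le) (Finset.mem_univ i)
  have hθ0 : 0 < w i₀ / 2 := half_pos (hw i₀)
  have hθ1 : w i₀ / 2 < 1 := by linarith [hle i₀]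
  have h1 : 0 < 1 - w i₀ / 2 := by linarith
  refine ⟨w i₀ / 2, fun i => (w i - w i₀ / 2 * e i) / (1 - w i₀ / 2), ⟨hθ0, hθ1⟩, fun i => ?_, ?_,
    fun i => ?_⟩
  · refine div_pos ?_ h1
    have h2 : w i₀ / 2 * e i ≤ w i₀ / 2 * 1 := by gcongr; exact he1 i
    linarith [hi₀ i]
  · rw [← Finset.sum_div, Finset.sum_sub_distrib, ← Finset.mul_sum, hw1, hes, mul_one,
      div_self h1.ne']
  · rw [mul_div_cancel₀ _ h1.ne']
    ring

/-! ### General exponents and Schwartz functions -/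

/-- The function `f`, cut off to the set where all coordinates are at most `m` in size and
`(m + 1)⁻¹ ≤ ‖f‖ ≤ m`. -/
def cutoff {n : ℕ} (f : (Fin n → ℝ) → ℂ) (m : ℕ) : (Fin n → ℝ) → ℂ :=
  Set.indicator {y | (∀ l, |y l| ≤ (m : ℝ)) ∧ ‖f y‖ ≤ m ∧ ((m : ℝ) + 1)⁻¹ ≤ ‖f y‖} f

lemma isTest_cutoff {n : ℕ} {f : (Fin n → ℝ) → ℂ} (hf : Measurable f) (m : ℕ) :
    IsTest m (cutoff f m) := by
  refine ⟨?_, fun y => ?_, fun y l hl => ?_⟩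
  · have h : MeasurableSet {y : Fin n → ℝ | ∀ l, |y l| ≤ (m : ℝ)} := by
      rw [Set.ofPred_forall]
      exact MeasurableSet.iInter fun l => measurableSet_le (by fun_prop) measurable_const
    exact hf.indicator (h.inter ((measurableSet_le hf.norm measurable_const).inter
      (measurableSet_le measurable_const hf.norm)))
  · unfold cutoff
    by_cases hy : y ∈ {y | (∀ l, |y l| ≤ (m : ℝ)) ∧ ‖f y‖ ≤ m ∧ ((m : ℝ) + 1)⁻¹ ≤ ‖f y‖}
    · rw [Set.indicator_of_mem hy]; exact hy.2.1
    · rw [Set.indicator_of_notMem hy]; simp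
  · exact Set.indicator_of_notMem (fun hy => hl.not_ge (hy.1 l)) _

lemma le_norm_cutoff {n : ℕ} {f : (Fin n → ℝ) → ℂ} {m : ℕ} {y : Fin n → ℝ}
    (hy : cutoff f m y ≠ 0) : ((m : ℝ) + 1)⁻¹ ≤ ‖cutoff f m y‖ := by
  have h := Set.mem_of_indicator_ne_zero hy
  rw [cutoff, Set.indicator_of_mem h]
  exact h.2.2

lemma norm_cutoff_le {n : ℕ} (f : (Fin n → ℝ) → ℂ) (m : ℕ) (y : Fin n → ℝ) :
    ‖cutoff f m y‖ ≤ ‖f y‖ := norm_indicator_le_norm_self _ _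

lemma eventually_cutoff_eq {n : ℕ} (f : (Fin n → ℝ) → ℂ) (y : Fin n → ℝ) :
    ∀ᶠ m : ℕ in Filter.atTop, cutoff f m y = f y := by
  by_cases hy : f y = 0
  · refine Filter.Eventually.of_forall fun m => ?_
    have := norm_cutoff_le f m y
    rw [hy, norm_zero] at this
    rw [hy, norm_le_zero_iff.1 this]
  have h0 : ∀ a : ℝ, ∀ᶠ m : ℕ in Filter.atTop, a ≤ m := fun a =>
    tendsto_natCast_atTop_atTop.eventually_ge_atTop a
  filter_upwards [Filter.eventually_all.2 fun l => h0 |y l|, h0 ‖f y‖, h0 ‖f y‖⁻¹] with m h1 h2 h3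
  refine Set.indicator_of_mem
    (s := {y | (∀ l, |y l| ≤ (m : ℝ)) ∧ ‖f y‖ ≤ m ∧ ((m : ℝ) + 1)⁻¹ ≤ ‖f y‖})
    ⟨h1, h2, ?_⟩ f
  exact inv_le_of_inv_le₀ (norm_pos_iff.2 hy) (by linarith)

/-- The bound with a power gain for arbitrary weights, for normalized functions, by interpolation
for their cutoffs and dominated convergence. -/
lemma exists_bound_of_normalized {n : ℕ} (hn : 1 ≤ n) {w : Fin (n + 1) → ℝ} (hw : ∀ i, 0 < w i)
    (hw1 : ∑ i, w i = 1) :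
    ∃ C ε : ℝ, 0 < ε ∧ ∀ F : Fin (n + 1) → (Fin n → ℝ) → ℂ, (∀ i, Measurable (F i)) →
      Normalized w F → ∀ r R : ℝ, 0 < r → r < R →
        ‖∫ x : Fin (n + 1) → ℝ, sharpKernel r R (∑ i, x i) • ∏ i, F i (i.removeNth x)‖ ≤
          C * Real.log (R / r) ^ (1 - ε) := by
  obtain ⟨C, δ, hC, hδ0, hδ1, hb⟩ := exists_sharp_bound hn
  have he1 : ∀ i, dyadicWeight n i ≤ 1 := fun i => by
    rw [← sum_dyadicWeight n]
    exact Finset.single_le_sum (fun j _ => (dyadicWeight_pos n j).le) (Finset.mem_univ i)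
  obtain ⟨θ, v, hθ, hv, hv1, hwv⟩ := exists_interpolation_weights hw hw1 he1 (sum_dyadicWeight n)
  refine ⟨2 + 2 ^ (1 - θ) * C ^ θ, θ * δ, mul_pos hθ.1 hδ0, fun F hF hN r R hr hrR => ?_⟩
  set L := Real.log (R / r) with hLdef
  have hL0 : 0 < L := Real.log_pos ((one_lt_div hr).2 hrR)
  have hκ := measurable_sharpKernel r R
  have hκD := lintegral_sharpKernel_le hr hrR
  have hD : 0 ≤ 2 * L := by positivity
  obtain ⟨hint, htriv⟩ := integrable_smul_prod hF hw hw1 hN hκ hD hκD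
  have hCθ : 0 ≤ (2 : ℝ) ^ (1 - θ) * C ^ θ := by positivity
  have hLe : 0 ≤ L ^ (1 - θ * δ) := by positivity
  -- For `L < 1` the trivial bound `2 * L` is at most `2 * L ^ (1 - θ * δ)`.
  rcases lt_or_ge L 1 with hL | hL
  · have h1 : L ≤ L ^ (1 - θ * δ) := by
      conv_lhs => rw [← Real.rpow_one L]
      exact Real.rpow_le_rpow_of_exponent_ge hL0 hL.le (by linarith [mul_pos hθ.1 hδ0])
    nlinarith
  have hcut : ∀ m : ℕ, ‖∫ x : Fin (n + 1) → ℝ,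
      sharpKernel r R (∑ i, x i) • ∏ i, cutoff (F i) m (i.removeNth x)‖ ≤
        (2 * L) ^ (1 - θ) * (C * L ^ (1 - δ)) ^ θ := fun m => by
    refine norm_integral_le_of_interpolation hκ hD hκD hθ hw hw1 hv (dyadicWeight_pos n) hwv
      (fun M G hG hGN => ?_) (fun M G hG hGN => hb M G hG hGN r R hr hrR hL)
      (c := ((m : ℝ) + 1)⁻¹) (by positivity) (fun i => isTest_cutoff (hF i) m)
      (fun i y hy => le_norm_cutoff hy) fun i => ?_
    · exact (integrable_smul_prod (fun i => (hG i).measurable) hv hv1 hGN hκ hD hκD).2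
    · refine (lintegral_mono fun y => ENNReal.ofReal_le_ofReal ?_).trans (hN i)
      exact Real.rpow_le_rpow (norm_nonneg _) (norm_cutoff_le _ _ _) (one_div_nonneg.2 (hw i).le)
  have hlim : Filter.Tendsto (fun m : ℕ => ∫ x : Fin (n + 1) → ℝ,
      sharpKernel r R (∑ i, x i) • ∏ i, cutoff (F i) m (i.removeNth x)) Filter.atTop
      (nhds (∫ x : Fin (n + 1) → ℝ, sharpKernel r R (∑ i, x i) • ∏ i, F i (i.removeNth x))) := by
    refine tendsto_integral_of_dominated_convergence
      (fun x => ‖sharpKernel r R (∑ i, x i) • ∏ i, F i (i.removeNth x)‖) (fun m => ?_) hint.norm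
      (fun m => ae_of_all _ fun x => ?_) (ae_of_all _ fun x => ?_)
    · have hm : ∀ i : Fin (n + 1), Measurable fun x : Fin (n + 1) → ℝ =>
          cutoff (F i) m (i.removeNth x) :=
        fun i => (isTest_cutoff (hF i) m).measurable.comp (measurable_removeNth i)
      have hk : Measurable fun x : Fin (n + 1) → ℝ => sharpKernel r R (∑ i, x i) := by fun_prop
      exact (hk.smul (Finset.measurable_prod _ fun i _ => hm i)).aestronglyMeasurable
    · rw [norm_smul, norm_smul, norm_prod, norm_prod]
      gcongr
      exact norm_cutoff_le _ _ _
    · refine tendsto_const_nhds.congr' ?_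
      filter_upwards [Filter.eventually_all.2 fun i : Fin (n + 1) =>
        eventually_cutoff_eq (F i) (i.removeNth x)] with m hm
      simp only [hm]
  refine (le_of_tendsto hlim.norm (Filter.Eventually.of_forall hcut)).trans ?_
  have h1 : (2 * L) ^ (1 - θ) * (C * L ^ (1 - δ)) ^ θ = 2 ^ (1 - θ) * C ^ θ * L ^ (1 - θ * δ) := by
    rw [Real.mul_rpow (by norm_num) hL0.le, Real.mul_rpow hC (by positivity),
      ← Real.rpow_mul hL0.le, show 1 - θ * δ = (1 - θ) + (1 - δ) * θ by ring,
      Real.rpow_add hL0]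
    ring
  rw [h1]
  nlinarith

lemma lintegral_norm_div_rpow_le {n : ℕ} {p c : ℝ} (hp : 0 < p) {f : (Fin n → ℝ) → ℂ}
    (hf : MemLp f (ENNReal.ofReal p))
    (hc : (eLpNorm f (ENNReal.ofReal p) volume).toReal < c) :
    ∫⁻ y, ENNReal.ofReal (‖f y / (c : ℂ)‖ ^ p) ≤ 1 := by
  have hc0 : 0 < c := ENNReal.toReal_nonneg.trans_lt hc
  have hp0 : ENNReal.ofReal p ≠ 0 := by simpa using hp
  have hfin : eLpNorm f (ENNReal.ofReal p) volume ≠ ⊤ := hf.2.ne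
  have h1 : eLpNorm f (ENNReal.ofReal p) volume ≤ ENNReal.ofReal c := by
    rw [← ENNReal.ofReal_toReal hfin]
    exact ENNReal.ofReal_le_ofReal hc.le
  have h2 : ∫⁻ y, ‖f y‖ₑ ^ p ≤ ENNReal.ofReal c ^ p := by
    rw [eLpNorm_eq_lintegral_rpow_enorm_toReal hp0 ENNReal.ofReal_ne_top,
      ENNReal.toReal_ofReal hp.le, one_div] at h1
    exact (ENNReal.rpow_inv_le_iff hp).1 h1
  have h3 : ∀ y, ENNReal.ofReal (‖f y / (c : ℂ)‖ ^ p) = (ENNReal.ofReal c ^ p)⁻¹ * ‖f y‖ₑ ^ p :=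
    fun y => by
      rw [norm_div, Complex.norm_real, Real.norm_of_nonneg hc0.le, Real.div_rpow (norm_nonneg _)
        hc0.le, ENNReal.ofReal_div_of_pos (by positivity),
        ← ENNReal.ofReal_rpow_of_nonneg (norm_nonneg _) hp.le,
        ← ENNReal.ofReal_rpow_of_nonneg hc0.le hp.le, ofReal_norm, ENNReal.div_eq_inv_mul]
  have hc1 : ENNReal.ofReal c ^ p ≠ 0 := by
    rw [ENNReal.ofReal_rpow_of_nonneg hc0.le hp.le]
    simpa using Real.rpow_pos_of_pos hc0 p
  have hc2 : ENNReal.ofReal c ^ p ≠ ⊤ := ENNReal.rpow_ne_top_of_nonneg hp.le ENNReal.ofReal_ne_top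
  simp only [h3]
  rw [lintegral_const_mul' _ _ (ENNReal.inv_ne_top.2 hc1)]
  calc _ ≤ (ENNReal.ofReal c ^ p)⁻¹ * ENNReal.ofReal c ^ p := by gcongr
    _ = 1 := ENNReal.inv_mul_cancel hc1 hc2

lemma measurableSet_truncationRegion (n : ℕ) (r R : ℝ) :
    MeasurableSet (truncationRegion n r R) := by
  have h : Measurable fun x : Fin (n + 1) → ℝ => |∑ i, x i| := by fun_prop
  exact (measurableSet_le measurable_const h).inter (measurableSet_le h measurable_const)

lemma indicator_simplexIntegrand {n : ℕ} (r R : ℝ) (F : Fin (n + 1) → (Fin n → ℝ) → ℂ) :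
    (truncationRegion n r R).indicator (simplexIntegrand F) =
      fun x => sharpKernel r R (∑ i, x i) • ∏ i, F i (i.removeNth x) := by
  funext x
  by_cases hx : x ∈ truncationRegion n r R
  · have hx' : r ≤ |∑ i, x i| ∧ |∑ i, x i| ≤ R := hx
    rw [Set.indicator_of_mem hx, simplexIntegrand, sharpKernel, if_pos hx', Complex.real_smul]
    push_cast
    ring
  · have hx' : ¬(r ≤ |∑ i, x i| ∧ |∑ i, x i| ≤ R) := hx
    rw [Set.indicator_of_notMem hx, sharpKernel, if_neg hx', zero_smul]

end SimplexHilbert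

end

open SimplexHilbert

theorem corollary2 (n : ℕ) (hn : 1 ≤ n) (p : Fin (n + 1) → ℝ)
    (hp : ∀ i, 1 < p i) (hsum : ∑ i, 1 / p i = 1) :
    ∃ C ε : ℝ, 0 < ε ∧
      ∀ (F : Fin (n + 1) → 𝓢(Fin n → ℝ, ℂ)) (r R : ℝ), 0 < r → r < R →
        IntegrableOn (simplexIntegrand fun i => ⇑(F i)) (truncationRegion n r R) volume ∧
        ‖truncatedSimplexHilbert r R fun i => ⇑(F i)‖ ≤
          C * Real.log (R / r) ^ (1 - ε) *
            ∏ i, (eLpNorm (F i) (ENNReal.ofReal (p i)) volume).toReal := by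
  have hp0 : ∀ i, 0 < p i := fun i => one_pos.trans (hp i)
  have hw : ∀ i, 0 < 1 / p i := fun i => one_div_pos.2 (hp0 i)
  obtain ⟨C, ε, hε, h⟩ := exists_bound_of_normalized hn hw hsum
  refine ⟨C, ε, hε, fun F r R hr hrR => ?_⟩
  set N : Fin (n + 1) → ℝ := fun i => (eLpNorm (F i) (ENNReal.ofReal (p i)) volume).toReal with hN
  have hN0 : ∀ i, 0 ≤ N i := fun i => ENNReal.toReal_nonneg
  -- Dividing by slightly more than the norm avoids a separate treatment of vanishing norms.
  set G : ℝ → Fin (n + 1) → (Fin n → ℝ) → ℂ := fun t i y => F i y / ((N i + t : ℝ) : ℂ) with hG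
  have hGm : ∀ t i, Measurable (G t i) := fun t i => (F i).continuous.measurable.div_const _
  have hGN : ∀ t, 0 < t → Normalized (fun i => 1 / p i) (G t) := fun t ht i => by
    simp only [one_div_one_div]
    exact lintegral_norm_div_rpow_le (hp0 i) ((F i).memLp _) (lt_add_of_pos_right _ ht)
  have hFG : ∀ t, 0 < t → (fun x : Fin (n + 1) → ℝ =>
      sharpKernel r R (∑ i, x i) • ∏ i, F i (i.removeNth x)) = fun x =>
        ((∏ i, (N i + t) : ℝ) : ℂ) * sharpKernel r R (∑ i, x i) • ∏ i, G t i (i.removeNth x) :=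
    fun t ht => by
      funext x
      have h1 : ((∏ i, (N i + t) : ℝ) : ℂ) ≠ 0 := by
        exact_mod_cast (Finset.prod_pos fun i _ => add_pos_of_nonneg_of_pos (hN0 i) ht).ne'
      simp only [hG, Finset.prod_div_distrib, Complex.real_smul]
      rw [Complex.ofReal_prod] at h1 ⊢
      field_simp
  have hS := measurableSet_truncationRegion n r R
  have hlog : 0 ≤ 2 * Real.log (R / r) := by
    have := Real.log_pos ((one_lt_div hr).2 hrR)
    positivity
  refine ⟨?_, ?_⟩
  · rw [← integrable_indicator_iff hS, indicator_simplexIntegrand, hFG 1 one_pos]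
    exact (integrable_smul_prod (hGm 1) hw hsum (hGN 1 one_pos) (measurable_sharpKernel r R) hlog
      (lintegral_sharpKernel_le hr hrR)).1.const_mul _
  rw [truncatedSimplexHilbert, ← integral_indicator hS, indicator_simplexIntegrand]
  have hbound : ∀ t, 0 < t →
      ‖∫ x : Fin (n + 1) → ℝ, sharpKernel r R (∑ i, x i) • ∏ i, F i (i.removeNth x)‖ ≤
        C * Real.log (R / r) ^ (1 - ε) * ∏ i, (N i + t) := fun t ht => by
    have h1 : 0 ≤ ∏ i, (N i + t) := Finset.prod_nonneg fun i _ => add_nonneg (hN0 i) ht.le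
    rw [hFG t ht, integral_const_mul, norm_mul, Complex.norm_real, Real.norm_of_nonneg h1, mul_comm]
    gcongr
    exact h (G t) (hGm t) (hGN t ht) r R hr hrR
  have hcont : Continuous fun t : ℝ => C * Real.log (R / r) ^ (1 - ε) * ∏ i, (N i + t) := by
    fun_prop
  have hlim := (hcont.tendsto 0).mono_left (nhdsWithin_le_nhds (s := Set.Ioi 0))
  simp only [add_zero] at hlim
  exact ge_of_tendsto hlim (eventually_mem_nhdsWithin.mono hbound)
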